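/- Let $F$ be a non-archimedean local field with ring of integers $\mathcal O$ and maximal ideal $\mathcal P$, and let $G=\mathrm{PGL}(2,F)$. Let $U\subset G$ be the image of the upper triangular unipotent matrices, $T\subset G$ the image of the diagonal matrices, identified with $F^\times$ by $\mathrm{diag}(a_{11},a_{22})\mapsto a_{11}/a_{22}$, and $T(\mathcal O)\simeq\mathcal O^\times$ its maximal compact subgroup. For $d\ge 0$ let $\Gamma_d\subset G$ be the image of the group of matrices $g\in \mathrm{GL}(2,\mathcal O)$ with $g_{21}\in\mathcal P^d$, and put $K=\Gamma_0$. Put $U_0=\mathcal O^\times$ and $U_r=1+\mathcal P^r$ for $r>0$. Let $x:\mathcal O^\times\to\mathbb C^\times$ be a (continuous) character, let $d=d(x)$ be the least $r\ge 0$ such that $x^2|_{U_r}=1$, and assume $d>0$. For $g\in\Gamma_d$ put $\tilde x(g)=x(g_{11}^2/\det g)$; this is a character of $\Gamma_d$. Let $G$ act by left shifts, $(g f)(h)=f(g^{-1}h)$, on the following spaces. * $V_x$: the locally constant functions $f:G\to\mathbb C$, compactly supported modulo $U$, with $f(gtu)=x(t)f(g)$ for $g\in G$, $t\in T(\mathcal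 O)$, $u\in U$. * $W_x=\mathrm{c\text{-}ind}_{\Gamma_d}^G\tilde x$: the locally constant compactly supported functions $\phi:G\to\mathbb C$ with $\phi(g\gamma)=\tilde x(\gamma)\phi(g)$ for $g\in G$, $\gamma\in\Gamma_d$. Let $f_0\in V_x$ be the function supported on $\Gamma_dU$ with $f_0(\gamma u)=\tilde x(\gamma)$ for $\gamma\in\Gamma_d$, $u\in U$, and let $\phi_0\in W_x$ be the function supported on $\Gamma_d$ and equal to $\tilde x$ there. Let $\mathrm{ch}_{\Gamma_d}$ be the normalized Haar measure on $\Gamma_d$, and put $\mu_0=\phi_0\,\mathrm{ch}_{\Gamma_d}$. For $f\in V_x$ and $\phi\in W_x$ define functions on $G$ by $$A(f)(g)=(f*\mu_0)(g)=\int_{G} f(gh^{-1})\,d\mu_0(h),\qquad B(\phi)(g)=\int_U\phi(gu)\,du,$$ where $du$ is the Haar measure on $U$ with $\int_{U\cap K}du=1$. Then $B$ is a $G$-morphism $W_x\to V_x$, and: a) $B(\phi_0)=f_0$. b) $A(f_0)=\phi_0$. c) $A$ is an isomorphism $V_x\to W_x$ of representations of $G$. d) The $\mathbb C$-algebras $\mathrm{End}_G(V_x)$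 and $\mathrm{End}_G(W_x)$ are isomorphic; conjugation by $A$, $S\mapsto ASA^{-1}$, is an isomorphism. -/

import Mathlib

open ValuativeRel MeasureTheory Matrix
open scoped MatrixGroups Pointwise

noncomputable section

namespace PGLTwo

section Topology

variable (F : Type*) [Field F] [TopologicalSpace F]

/-- `PGL(2, F)` carries the quotient topology from `GL(2, F)`. -/
instance instTopologicalSpace : TopologicalSpace PGL(2, F) :=
  inferInstanceAs (TopologicalSpace (GL (Fin 2) F ⧸ Subgroup.center (GL (Fin 2) F)))

/-- `PGL(2, F)` carries its Borel sigma-algebra. -/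
instance instMeasurableSpace : MeasurableSpace PGL(2, F) := borel _

instance instBorelSpace : BorelSpace PGL(2, F) := ⟨rfl⟩

instance instIsTopologicalGroup [IsTopologicalRing F] : IsTopologicalGroup PGL(2, F) :=
  inferInstanceAs (IsTopologicalGroup (GL (Fin 2) F ⧸ Subgroup.center (GL (Fin 2) F)))

instance instLocallyCompactSpace [IsTopologicalRing F] [T2Space F] [LocallyCompactSpace F] :
    LocallyCompactSpace PGL(2, F) := by
  have : LocallyCompactSpace (Matrix (Fin 2) (Fin 2) F) :=
    inferInstanceAs (LocallyCompactSpace (Fin 2 → Fin 2 → F))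
  have : LocallyCompactSpace (GL (Fin 2) F) :=
    inferInstanceAs (LocallyCompactSpace (Matrix (Fin 2) (Fin 2) F)ˣ)
  exact inferInstanceAs (LocallyCompactSpace (GL (Fin 2) F ⧸ Subgroup.center (GL (Fin 2) F)))

/-- The topology of a local field is Hausdorff. -/
instance instT2Space [ValuativeRel F] [IsNonarchimedeanLocalField F] : T2Space F := by
  let := IsTopologicalAddGroup.rightUniformSpace F
  have := isUniformAddGroup_of_addCommGroup (G := F)
  infer_instance

end Topology

section Groups

variable {F : Type*} [Field F]

/-- The image in `PGL(2, F)` of the upper triangular unipotent matrix `(1, b; 0, 1)`. -/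
def unip (b : F) : PGL(2, F) :=
  ProjGenLinGroup.mk (GeneralLinearGroup.upperRightHom b)

variable (F) in
/-- The subgroup `U` of upper triangular unipotent elements of `PGL(2, F)`. -/
def U : Subgroup PGL(2, F) where
  carrier := Set.range unip
  one_mem' := ⟨0, by simp [unip]⟩
  mul_mem' := by
    rintro _ _ ⟨a, rfl⟩ ⟨b, rfl⟩
    exact ⟨a + b, by simp [unip, AddChar.map_add_eq_mul]⟩
  inv_mem' := by
    rintro _ ⟨a, rfl⟩
    exact ⟨-a, by rw [unip, unip, AddChar.map_neg_eq_inv, map_inv]⟩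

/-- The image in `PGL(2, F)` of the diagonal matrix `diag(a, 1)`. Under the identification
`diag(a₁₁, a₂₂) ↦ a₁₁ / a₂₂` of the diagonal torus with `Fˣ`, this is the element
corresponding to `a`. -/
def tor (a : Fˣ) : PGL(2, F) :=
  ProjGenLinGroup.mk (GeneralLinearGroup.mkOfDetNeZero !![(a : F), 0; 0, 1] (by simp))

/-- The function `g ↦ g₁₁² / det g` on `PGL(2, F)`. -/
def ratio (g : PGL(2, F)) : F :=
  Quotient.lift (s := QuotientGroup.leftRel (Subgroup.center (GL (Fin 2) F)))
    (fun h : GL (Fin 2) F => h 0 0 ^ 2 / Matrix.det (h : Matrix (Fin 2) (Fin 2) F))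
    (by
      intro a b hab
      have h : (ProjGenLinGroup.mk a : PGL(2, F)) = ProjGenLinGroup.mk b := Quotient.sound hab
      obtain ⟨u, rfl⟩ := ProjGenLinGroup.mk_eq_mk_iff.1 h
      have hu : (u : F) ≠ 0 := u.ne_zero
      have hd : Matrix.det (a : Matrix (Fin 2) (Fin 2) F) ≠ 0 := a.det_ne_zero
      simp only [Units.val_mul, GeneralLinearGroup.coe_scalar, Matrix.scalar_apply,
        Matrix.det_mul, Matrix.det_diagonal, Fin.prod_univ_two, Matrix.mul_diagonal]
      field_simp) g

theorem ratio_mk (h : GL (Fin 2) F) :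
    ratio (ProjGenLinGroup.mk h) = h 0 0 ^ 2 / Matrix.det (h : Matrix (Fin 2) (Fin 2) F) :=
  rfl

theorem ratio_mul_unip (g : PGL(2, F)) (b : F) : ratio (g * unip b) = ratio g := by
  induction g using ProjGenLinGroup.induction_on with | mk h =>
  rw [unip, ← map_mul, ratio_mk, ratio_mk]
  simp [GeneralLinearGroup.upperRightHom, Matrix.mul_apply, Fin.sum_univ_two]

end Groups

section Arithmetic

variable {F : Type*} [Field F] [ValuativeRel F]

variable (F) in
/-- The group of matrices in `GL(2, 𝒪)` whose lower left entry lies in `𝓂 ^ d`. -/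
def GammaTilde (d : ℕ) : Subgroup (GL (Fin 2) 𝒪[F]) where
  carrier := {g | g 1 0 ∈ 𝓂[F] ^ d}
  one_mem' := by simp
  mul_mem' := by
    intro a b ha hb
    simp only [Set.mem_ofPred_eq, Units.val_mul, Matrix.mul_apply, Fin.sum_univ_two] at *
    exact add_mem (Ideal.mul_mem_right _ _ ha) (Ideal.mul_mem_left _ _ hb)
  inv_mem' := by
    intro a ha
    simp only [Set.mem_ofPred_eq, GeneralLinearGroup.coe_inv, Matrix.inv_def,
      Matrix.adjugate_fin_two] at *
    simpa using (Ideal.mul_mem_left _ (Ring.inverse a.1.det) (neg_mem ha))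

variable (F) in
/-- The subgroup `Γ_d` of `PGL(2, F)`: the image of the group of matrices in `GL(2, 𝒪)` whose
lower left entry lies in `𝓂 ^ d`. In particular `Γ_0` is the image of `GL(2, 𝒪)`. -/
def Gamma (d : ℕ) : Subgroup PGL(2, F) :=
  (GammaTilde F d).map
    (ProjGenLinGroup.mk.comp (GeneralLinearGroup.map (algebraMap 𝒪[F] F)))

variable (F) in
/-- The filtration subgroups of `𝒪ˣ`: `U_0 = 𝒪ˣ` and `U_r = 1 + 𝓂 ^ r` for `r > 0`. -/
def unitFiltration (r : ℕ) : Set 𝒪[F]ˣ := {u | (u : 𝒪[F]) - 1 ∈ 𝓂[F] ^ r}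

variable [TopologicalSpace F]

/-- The depth `d(x)` of a character `x` of `𝒪ˣ`: the least `r` such that `x ^ 2` is trivial on
the `r`-th filtration subgroup. -/
def depth (x : 𝒪[F]ˣ →ₜ* ℂˣ) : ℕ := sInf {r | ∀ u ∈ unitFiltration F r, x u ^ 2 = 1}

open scoped Classical in
/-- The character `x` of `𝒪ˣ`, viewed as a function on `F` that vanishes outside `𝒪ˣ`. -/
def extChar (x : 𝒪[F]ˣ →ₜ* ℂˣ) (a : F) : ℂ :=
  if h : ∃ u : 𝒪[F]ˣ, ((u : 𝒪[F]) : F) = a then (x h.choose : ℂ) else 0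

theorem extChar_coe (x : 𝒪[F]ˣ →ₜ* ℂˣ) (u : 𝒪[F]ˣ) :
    extChar x ((u : 𝒪[F]) : F) = (x u : ℂ) := by
  have h : ∃ v : 𝒪[F]ˣ, ((v : 𝒪[F]) : F) = ((u : 𝒪[F]) : F) := ⟨u, rfl⟩
  have h' : h.choose = u := Units.ext (Subtype.ext h.choose_spec)
  rw [extChar, dif_pos h, h']

/-- `x̃(g) = x(g₁₁² / det g)`. It is used only for `g` in `Γ_d`, `d = d(x) > 0`, where
`g₁₁² / det g` is a unit of `𝒪`, and for `g` in `Γ_d U`. -/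
def tildeChar (x : 𝒪[F]ˣ →ₜ* ℂˣ) (g : PGL(2, F)) : ℂ := extChar x (ratio g)

/-- `φ₀` is supported on `Γ_d` and equal to `x̃` there. -/
def phi0 (x : 𝒪[F]ˣ →ₜ* ℂˣ) : PGL(2, F) → ℂ :=
  Set.indicator (Gamma F (depth x) : Set PGL(2, F)) (tildeChar x)

/-- `f₀` is supported on `Γ_d U` and `f₀(γ u) = x̃(γ)` for `γ ∈ Γ_d` and `u ∈ U`
(the function `x̃` is right invariant under `U`; see `f0_mul`). -/
def f0 (x : 𝒪[F]ˣ →ₜ* ℂˣ) : PGL(2, F) → ℂ :=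
  Set.indicator ((Gamma F (depth x) : Set PGL(2, F)) * (U F : Set PGL(2, F))) (tildeChar x)

theorem f0_mul (x : 𝒪[F]ˣ →ₜ* ℂˣ) {γ u : PGL(2, F)} (hγ : γ ∈ Gamma F (depth x))
    (hu : u ∈ U F) : f0 x (γ * u) = tildeChar x γ := by
  rw [f0, Set.indicator_of_mem (Set.mul_mem_mul hγ hu)]
  obtain ⟨b, rfl⟩ := hu
  rw [tildeChar, ratio_mul_unip, tildeChar]

end Arithmetic

section Representations

/-- The action of a group on complex functions by left shifts, `(g f)(h) = f(g⁻¹ h)`. -/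
def leftShift (G : Type*) [Group G] : Representation ℂ G (G → ℂ) where
  toFun g :=
    { toFun := fun f h => f (g⁻¹ * h)
      map_add' := fun _ _ => rfl
      map_smul' := fun _ _ => rfl }
  map_one' := by ext; simp
  map_mul' a b := by ext; simp [mul_assoc]

@[simp]
theorem leftShift_apply {G : Type*} [Group G] (g : G) (f : G → ℂ) (h : G) :
    leftShift G g f h = f (g⁻¹ * h) := rfl

variable {F : Type*} [Field F] [ValuativeRel F] [TopologicalSpace F] [IsTopologicalRing F]

/-- `V_x`: the locally constant functions `f` on `G = PGL(2, F)`, compactly supported modulo `U`,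
with `f(g t u) = x(t) f(g)` for `t` in the maximal compact subgroup `T(𝒪) ≃ 𝒪ˣ` of the diagonal
torus and `u ∈ U`. -/
def V (x : 𝒪[F]ˣ →ₜ* ℂˣ) : Subrepresentation (leftShift PGL(2, F)) where
  toSubmodule :=
    { carrier := {f | IsLocallyConstant f ∧
        (∃ C : Set PGL(2, F), IsCompact C ∧ Function.support f ⊆ C * (U F : Set PGL(2, F))) ∧
        ∀ (g : PGL(2, F)) (a : 𝒪[F]ˣ), ∀ u ∈ U F,
          f (g * tor (Units.map (algebraMap 𝒪[F] F).toMonoidHom a) * u) = x a * f g}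
      zero_mem' := ⟨IsLocallyConstant.const 0, ⟨∅, isCompact_empty, by simp⟩, by simp⟩
      add_mem' := by
        rintro f f' ⟨h1, ⟨C, hC, hs⟩, h3⟩ ⟨h1', ⟨C', hC', hs'⟩, h3'⟩
        refine ⟨h1.add h1', ⟨C ∪ C', hC.union hC', ?_⟩, fun g a u hu => ?_⟩
        · rw [Set.union_mul]
          exact (Function.support_add f f').trans (Set.union_subset_union hs hs')
        · simp only [Pi.add_apply, h3 g a u hu, h3' g a u hu, mul_add]
      smul_mem' := by
        rintro c f ⟨h1, ⟨C, hC, hs⟩, h3⟩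
        refine ⟨h1.comp (c • ·), ⟨C, hC, (Function.support_const_smul_subset c f).trans hs⟩,
          fun g a u hu => ?_⟩
        simp only [Pi.smul_apply, smul_eq_mul, h3 g a u hu, mul_left_comm] }
  apply_mem_toSubmodule := by
    rintro g f ⟨h1, ⟨C, hC, hs⟩, h3⟩
    refine ⟨h1.comp_continuous (continuous_const_mul g⁻¹), ⟨g • C, hC.smul g, fun h hh => ?_⟩,
      fun h a u hu => ?_⟩
    · obtain ⟨c, hc, u, hu, hcu⟩ := hs (show g⁻¹ * h ∈ Function.support f from hh)
      refine ⟨g * c, ⟨c, hc, rfl⟩, u, hu, ?_⟩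
      simp only [mul_assoc] at hcu ⊢
      rw [hcu, mul_inv_cancel_left]
    · simpa only [leftShift_apply, mul_assoc] using h3 (g⁻¹ * h) a u hu

/-- `W_x`: the locally constant, compactly supported functions `φ` on `G = PGL(2, F)` with
`φ(g γ) = x̃(γ) φ(g)` for `γ ∈ Γ_d`, `d = d(x)`. -/
def W (x : 𝒪[F]ˣ →ₜ* ℂˣ) : Subrepresentation (leftShift PGL(2, F)) where
  toSubmodule :=
    { carrier := {φ | IsLocallyConstant φ ∧ HasCompactSupport φ ∧
        ∀ (g : PGL(2, F)), ∀ γ ∈ Gamma F (depth x), φ (g * γ) = tildeChar x γ * φ g}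
      zero_mem' := ⟨IsLocallyConstant.const 0, HasCompactSupport.zero, by simp⟩
      add_mem' := by
        rintro f f' ⟨h1, h2, h3⟩ ⟨h1', h2', h3'⟩
        refine ⟨h1.add h1', h2.add h2', fun g γ hγ => ?_⟩
        simp only [Pi.add_apply, h3 g γ hγ, h3' g γ hγ, mul_add]
      smul_mem' := by
        rintro c f ⟨h1, h2, h3⟩
        refine ⟨h1.comp (c • ·), h2.smul_left (f := fun _ => c), fun g γ hγ => ?_⟩
        simp only [Pi.smul_apply, smul_eq_mul, h3 g γ hγ, mul_left_comm] }
  apply_mem_toSubmodule := by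
    rintro g f ⟨h1, h2, h3⟩
    refine ⟨h1.comp_continuous (continuous_const_mul g⁻¹),
      h2.comp_homeomorph (Homeomorph.mulLeft g⁻¹), fun h γ hγ => ?_⟩
    simpa only [leftShift_apply, mul_assoc] using h3 (g⁻¹ * h) γ hγ

/-- The representation `τ_x` of `G` by left shifts on `V_x`. -/
abbrev tau (x : 𝒪[F]ˣ →ₜ* ℂˣ) : Representation ℂ PGL(2, F) (V x).toSubmodule :=
  (V x).toRepresentation

/-- The representation of `G` by left shifts on `W_x`. -/
abbrev rho (x : 𝒪[F]ˣ →ₜ* ℂˣ) : Representation ℂ PGL(2, F) (W x).toSubmodule :=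
  (W x).toRepresentation

end Representations

section Operators

variable {F : Type*} [Field F] [ValuativeRel F] [TopologicalSpace F]
  [IsNonarchimedeanLocalField F]

/-- `ch_R`, the normalized Haar measure on an open compact subgroup `R`, as a measure on `G`. -/
def ch (R : Subgroup PGL(2, F)) : Measure PGL(2, F) :=
  (Measure.haar (R : Set PGL(2, F)))⁻¹ • Measure.haar.restrict (R : Set PGL(2, F))

/-- The convolution `f ∗ (φ ν)` of a function `f` with the measure `φ ν` having density `φ` with
respect to `ν`: `(f ∗ μ)(g) = ∫ f(g h⁻¹) dμ(h)`. -/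
def conv (f φ : PGL(2, F) → ℂ) (ν : Measure PGL(2, F)) (g : PGL(2, F)) : ℂ :=
  ∫ h, f (g * h⁻¹) * φ h ∂ν

/-- `A(f) = f ∗ μ₀` with `μ₀ = φ₀ ch_{Γ_d}`. -/
def opA (x : 𝒪[F]ˣ →ₜ* ℂˣ) (f : PGL(2, F) → ℂ) : PGL(2, F) → ℂ :=
  conv f (phi0 x) (ch (Gamma F (depth x)))

/-- `B(φ)(g) = ∫_U φ(g u) du`, where `du` is the Haar measure on `U ≃ F` normalized so that
`U ∩ K ≃ 𝒪` has volume one. -/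
def opB (φ : PGL(2, F) → ℂ) (g : PGL(2, F)) : ℂ :=
  letI : MeasurableSpace F := borel F
  haveI : BorelSpace F := ⟨rfl⟩
  ∫ b : F, φ (g * unip b) ∂((Measure.addHaar (𝒪[F] : Set F))⁻¹ • (Measure.addHaar : Measure F))

end Operators

end PGLTwo

end

noncomputable section

/-! `A` and `B` commute with left shifts, so it suffices to know them on generators: `phi0`
generates `W x`, `f0` generates `V x`, and the two operators exchange these vectors. Hence `B ∘ A`
and `A ∘ B` are identities, and conjugation by `A` identifies the endomorphism algebras.

Generation of `W x` is formal, since a compactly supported function meets only finitely many cosets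
of `Γ_d` (`W_le_translateSpan`). For `V x`, let `f_m` be the analogue of `f0` supported on `Γ_m U`
(`fAux`). The Iwasawa decomposition and local constancy write every element of `V x` as a finite
combination of translates of various `f_m`, `m ≥ d` (`V_le_translateSpan`). Each `f_(m+1)` is an
average of translates of `f_m` by elements of `U`: where `f_m` lives but `f_(m+1)` does not, the
average is a character sum, which vanishes because `x ^ 2` is nontrivial on `U_(d-1)`
(`sum_fAux_unip`).

The identity `B(φ₀) = f₀` is a volume computation (`integrable_and_opB_phi0`). For `A(f₀) = φ₀`
(`opA_f0`), the function `A(f₀)` is `x̃`-equivariant under `Γ_d` on both sides and lives on `Γ_d U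
Γ_d`. At `u ∈ U` outside `Γ_d` there are `γ₁ u = u γ₂` in which `γ₁, γ₂ ∈ Γ_d` have different values
of `x̃`, so the value there is zero (`opA_f0_unip`). -/

namespace PGLTwo

set_option linter.unusedSectionVars false

/-! ### Valuations and powers of the maximal ideal -/

section Uniformizer

variable (F : Type*) [Field F] [ValuativeRel F] [TopologicalSpace F]
  [IsNonarchimedeanLocalField F]

/-- A chosen uniformizer of a local field. -/
def unif : F := ((IsDiscreteValuationRing.exists_irreducible 𝒪[F]).choose : F)

theorem unif_spec : ∃ h : unif F ∈ 𝒪[F], Irreducible (⟨unif F, h⟩ : 𝒪[F]) :=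
  ⟨Subtype.property _, (IsDiscreteValuationRing.exists_irreducible 𝒪[F]).choose_spec⟩

theorem unif_ne_zero : unif F ≠ 0 := by
  obtain ⟨h, hi⟩ := unif_spec F
  exact fun h0 => hi.ne_zero (Subtype.ext h0)

/-- The valuation of the chosen uniformizer. -/
def pv : ValueGroupWithZero F := valuation F (unif F)

theorem pv_ne_zero : pv F ≠ 0 := (valuation F).ne_zero_iff.2 (unif_ne_zero F)

theorem pv_pos : 0 < pv F := zero_lt_iff.2 (pv_ne_zero F)

variable {F}

theorem isUnit_integer_iff (a : 𝒪[F]) : IsUnit a ↔ valuation F (a : F) = 1 :=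
  Valuation.Integers.isUnit_iff_valuation_eq_one (Valuation.integer.integers (valuation F))

theorem exists_unit_coe_eq_iff {a : F} :
    (∃ u : 𝒪[F]ˣ, ((u : 𝒪[F]) : F) = a) ↔ valuation F a = 1 := by
  constructor
  · rintro ⟨u, rfl⟩
    exact (isUnit_integer_iff _).1 u.isUnit
  · intro h
    obtain ⟨u, hu⟩ := (isUnit_integer_iff (⟨a, h.le⟩ : 𝒪[F])).2 h
    exact ⟨u, by rw [hu]⟩

theorem mem_maximalIdeal_pow_iff (a : 𝒪[F]) (m : ℕ) :
    a ∈ 𝓂[F] ^ m ↔ valuation F (a : F) ≤ pv F ^ m := by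
  obtain ⟨h, hi⟩ := unif_spec F
  rw [hi.maximalIdeal_eq, Ideal.span_singleton_pow, Ideal.mem_span_singleton,
    (Valuation.integer.integers (valuation F)).dvd_iff_le]
  rw [map_pow, map_pow]
  rfl

theorem pv_lt_one : pv F < 1 := by
  obtain ⟨h, hi⟩ := unif_spec F
  refine lt_of_le_of_ne h fun h1 => hi.not_isUnit ((isUnit_integer_iff _).2 h1)

theorem le_pv_iff_lt_one {a : F} : valuation F a ≤ pv F ↔ valuation F a < 1 := by
  refine ⟨fun h => h.trans_lt pv_lt_one, fun h => ?_⟩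
  have := mem_maximalIdeal_pow_iff (⟨a, h.le⟩ : 𝒪[F]) 1
  rw [pow_one, pow_one] at this
  rw [← this, IsLocalRing.mem_maximalIdeal, mem_nonunits_iff, isUnit_integer_iff]
  exact h.ne

theorem exists_valuation_eq_zpow {a : F} (ha : a ≠ 0) : ∃ n : ℤ, valuation F a = pv F ^ n := by
  have key : ∀ b : F, b ≠ 0 → valuation F b ≤ 1 → ∃ n : ℕ, valuation F b = pv F ^ n := by
    intro b hb hb1
    obtain ⟨h, hi⟩ := unif_spec F
    obtain ⟨n, u, hn⟩ := IsDiscreteValuationRing.eq_unit_mul_pow_irreducible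
      (x := (⟨b, hb1⟩ : 𝒪[F])) (fun h0 => hb (congrArg Subtype.val h0)) hi
    refine ⟨n, ?_⟩
    have h1 := congrArg (fun z : 𝒪[F] => valuation F (z : F)) hn
    simpa [(isUnit_integer_iff _).1 u.isUnit, pv] using h1
  rcases le_total (valuation F a) 1 with h | h
  · obtain ⟨n, hn⟩ := key a ha h
    exact ⟨n, by simpa using hn⟩
  · obtain ⟨n, hn⟩ := key a⁻¹ (inv_ne_zero ha) (by simpa using inv_le_one_of_one_le₀ h)
    refine ⟨-n, ?_⟩
    rw [_root_.zpow_neg, zpow_natCast, ← hn, map_inv₀, inv_inv]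

theorem isOpen_valuation_le {γ : ValueGroupWithZero F} (hγ : γ ≠ 0) :
    IsOpen {a : F | valuation F a ≤ γ} := by
  rw [isOpen_iff_mem_nhds]
  intro a ha
  rw [IsValuativeTopology.mem_nhds_iff']
  refine ⟨Units.mk0 γ hγ, fun b hb => ?_⟩
  have : b = a + (b - a) := by ring
  rw [this]
  exact (valuation F).map_add_le ha (le_of_lt hb)

theorem exists_pow_subset_of_mem_nhds_zero {s : Set F} (hs : s ∈ nhds (0 : F)) :
    ∃ m : ℕ, ∀ a : F, valuation F a ≤ pv F ^ m → a ∈ s := by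
  obtain ⟨γ, hγ⟩ := (IsValuativeTopology.mem_nhds_zero_iff s).1 hs
  obtain ⟨m, hm⟩ := exists_pow_lt₀ (pv_lt_one (F := F)) γ
  exact ⟨m, fun a ha => hγ (ha.trans_lt hm)⟩

theorem valuation_eq_one_of_sub {a b : F} (ha : valuation F a = 1) (h : valuation F (b - a) < 1) :
    valuation F b = 1 := by
  rw [← ha]
  exact Valuation.map_eq_of_sub_lt _ (by rwa [ha])

theorem pv_pow_lt_one {m : ℕ} (hm : 0 < m) : pv F ^ m < 1 :=
  pow_lt_one₀ zero_le pv_lt_one hm.ne'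

theorem pv_pow_le_one (m : ℕ) : pv F ^ m ≤ 1 := pow_le_one₀ zero_le pv_lt_one.le

theorem pv_pow_anti {m n : ℕ} (h : m ≤ n) : pv F ^ n ≤ pv F ^ m :=
  pow_le_pow_right_of_le_one' pv_lt_one.le h

end Uniformizer

/-! ### The character `x` near the identity -/

section Character

variable {F : Type*} [Field F] [ValuativeRel F] [TopologicalSpace F]
  [IsNonarchimedeanLocalField F] (x : 𝒪[F]ˣ →ₜ* ℂˣ)

theorem extChar_eq_zero {a : F} (ha : valuation F a ≠ 1) : extChar x a = 0 := by
  rw [extChar, dif_neg]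
  rwa [exists_unit_coe_eq_iff]

theorem valuation_eq_one_of_extChar_ne_zero {a : F} (ha : extChar x a ≠ 0) :
    valuation F a = 1 := by
  by_contra h
  exact ha (extChar_eq_zero x h)

theorem extChar_ne_zero {a : F} (ha : valuation F a = 1) : extChar x a ≠ 0 := by
  obtain ⟨u, rfl⟩ := exists_unit_coe_eq_iff.2 ha
  rw [extChar_coe]
  exact Units.ne_zero _

@[simp]
theorem extChar_one : extChar x (1 : F) = 1 := by
  simpa using extChar_coe x 1

theorem extChar_mul {a : F} (ha : valuation F a = 1) (b : F) :
    extChar x (a * b) = extChar x a * extChar x b := by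
  by_cases hb : valuation F b = 1
  · obtain ⟨u, rfl⟩ := exists_unit_coe_eq_iff.2 ha
    obtain ⟨w, rfl⟩ := exists_unit_coe_eq_iff.2 hb
    have := extChar_coe x (u * w)
    rw [Units.val_mul, Subring.coe_mul] at this
    rw [this, extChar_coe, extChar_coe, map_mul, Units.val_mul]
  · rw [extChar_eq_zero x hb, mul_zero, extChar_eq_zero]
    rwa [map_mul, ha, one_mul]

theorem extChar_sq_eq_one (hx : 0 < depth x) {a : F}
    (ha : valuation F (a - 1) ≤ pv F ^ depth x) : extChar x (a ^ 2) = 1 := by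
  have h1 : valuation F a = 1 :=
    valuation_eq_one_of_sub (map_one _) (ha.trans_lt (pv_pow_lt_one hx))
  obtain ⟨u, rfl⟩ := exists_unit_coe_eq_iff.2 h1
  -- An infimum of the empty set of naturals is `0`, so positive depth forces the set to be
  -- nonempty.
  have hne : {r | ∀ u ∈ unitFiltration F r, x u ^ 2 = 1}.Nonempty := by
    by_contra h
    rw [Set.not_nonempty_iff_eq_empty] at h
    rw [depth, h, Nat.sInf_empty] at hx
    exact hx.false
  have h2 : x u ^ 2 = 1 :=
    Nat.sInf_mem hne u ((mem_maximalIdeal_pow_iff _ _).2 (by simpa [depth] using ha))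
  rw [sq, extChar_mul x h1, extChar_coe, ← Units.val_mul, ← sq, h2, Units.val_one]

/-- Minimality of the depth. When `d = 1` the bound on `c` only says that `c` is integral, so that
`1 + c` is a unit has to be recorded separately. -/
theorem exists_extChar_sq_ne_one (hx : 0 < depth x) :
    ∃ c : F, valuation F c ≤ pv F ^ (depth x - 1) ∧ valuation F (1 + c) = 1 ∧
      extChar x ((1 + c) ^ 2) ≠ 1 := by
  have h := Nat.notMem_of_lt_sInf (Nat.sub_lt hx one_pos : depth x - 1 < depth x)
  simp only [Set.mem_ofPred_eq, not_forall] at h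
  obtain ⟨u, hu, hu2⟩ := h
  have hu1 : valuation F ((u : 𝒪[F]) : F) = 1 := exists_unit_coe_eq_iff.1 ⟨u, rfl⟩
  refine ⟨((u : 𝒪[F]) : F) - 1, ?_, ?_, ?_⟩
  · simpa using (mem_maximalIdeal_pow_iff _ _).1 hu
  · rwa [add_sub_cancel]
  · rw [add_sub_cancel, sq, extChar_mul x hu1, extChar_coe, ← Units.val_mul, ← sq]
    exact fun h => hu2 (Units.ext h)

/-- On `U_d` the values of `x` are `±1`, and continuity at `1` keeps them within distance `1` of
`1`, which excludes `-1`. -/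
theorem exists_extChar_eq_one (hx : 0 < depth x) :
    ∃ n : ℕ, ∀ a : F, valuation F (a - 1) ≤ pv F ^ n → extChar x a = 1 := by
  have hO : ∀ᶠ u : 𝒪[F]ˣ in nhds 1, ‖((x u : ℂˣ) : ℂ) - 1‖ < 1 := by
    have hc : Continuous fun u : 𝒪[F]ˣ => ‖((x u : ℂˣ) : ℂ) - 1‖ :=
      ((Units.continuous_val.comp (map_continuous x)).sub continuous_const).norm
    exact hc.continuousAt.eventually_lt continuousAt_const (by simp)
  -- The unit group is compact, so it carries the topology induced from `F`.
  have hemb : Topology.IsClosedEmbedding fun u : 𝒪[F]ˣ => ((u : 𝒪[F]) : F) :=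
    (continuous_subtype_val.comp Units.continuous_val).isClosedEmbedding
      (Subtype.val_injective.comp Units.val_injective)
  rw [hemb.isInducing.nhds_eq_comap, Filter.eventually_comap] at hO
  have hO' : ∀ᶠ b : F in nhds 0, ∀ u : 𝒪[F]ˣ, ((u : 𝒪[F]) : F) = 1 + b →
      ‖((x u : ℂˣ) : ℂ) - 1‖ < 1 := by
    have hc : Filter.Tendsto (fun b : F => 1 + b) (nhds 0) (nhds 1) := by
      have := (continuous_const_add (1 : F)).tendsto 0
      rwa [add_zero] at this
    exact hc.eventually hO
  obtain ⟨n, hn⟩ := exists_pow_subset_of_mem_nhds_zero hO'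
  refine ⟨max n (depth x), fun a ha => ?_⟩
  have hd : valuation F (a - 1) ≤ pv F ^ depth x := ha.trans (pv_pow_anti (le_max_right _ _))
  have h1 : valuation F a = 1 :=
    valuation_eq_one_of_sub (map_one _) (hd.trans_lt (pv_pow_lt_one hx))
  have h2 := extChar_sq_eq_one x hx hd
  rw [sq, extChar_mul x h1] at h2
  obtain ⟨u, rfl⟩ := exists_unit_coe_eq_iff.2 h1
  have h3 := hn _ (ha.trans (pv_pow_anti (le_max_left _ _))) u (by ring)
  rw [extChar_coe] at h2 ⊢
  rcases mul_self_eq_one_iff.1 h2 with h | h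
  · exact h
  · rw [h] at h3
    norm_num at h3

end Character

/-! ### The coordinates `ratio` and `slope` on the open cell of `G / U` -/

section Coordinates

variable {F : Type*} [Field F]

/-- The function `g ↦ g₂₁ / g₁₁` on `PGL(2, F)`. -/
def slope (g : PGL(2, F)) : F :=
  Quotient.lift (s := QuotientGroup.leftRel (Subgroup.center (GL (Fin 2) F)))
    (fun h : GL (Fin 2) F => h 1 0 / h 0 0)
    (by
      intro a b hab
      have h : (ProjGenLinGroup.mk a : PGL(2, F)) = ProjGenLinGroup.mk b := Quotient.sound hab
      obtain ⟨u, rfl⟩ := ProjGenLinGroup.mk_eq_mk_iff.1 h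
      have hu : (u : F) ≠ 0 := u.ne_zero
      simp only [Units.val_mul, GeneralLinearGroup.coe_scalar, Matrix.scalar_apply,
        Matrix.mul_diagonal]
      rw [mul_div_mul_right _ _ hu]) g

theorem slope_mk (h : GL (Fin 2) F) : slope (ProjGenLinGroup.mk h) = h 1 0 / h 0 0 :=
  rfl

theorem ratio_mk' (h : GL (Fin 2) F) :
    ratio (ProjGenLinGroup.mk h) = h 0 0 ^ 2 / (h 0 0 * h 1 1 - h 0 1 * h 1 0) := by
  rw [ratio_mk, Matrix.det_fin_two]

theorem det_ne_zero' (h : GL (Fin 2) F) : h 0 0 * h 1 1 - h 0 1 * h 1 0 ≠ 0 := by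
  rw [← Matrix.det_fin_two]
  exact h.det_ne_zero

theorem slope_mul_unip (g : PGL(2, F)) (b : F) : slope (g * unip b) = slope g := by
  induction g using ProjGenLinGroup.induction_on with | mk h =>
  rw [unip, ← map_mul, slope_mk, slope_mk]
  simp [GeneralLinearGroup.upperRightHom, Matrix.mul_apply, Fin.sum_univ_two]

theorem ratio_mul_tor (g : PGL(2, F)) (a : Fˣ) : ratio (g * tor a) = a * ratio g := by
  induction g using ProjGenLinGroup.induction_on with | mk h =>
  have := det_ne_zero' h
  have := a.ne_zero
  rw [tor, ← map_mul, ratio_mk, ratio_mk']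
  simp [Matrix.det_mul, Matrix.mul_apply, Fin.sum_univ_two, GeneralLinearGroup.mkOfDetNeZero,
    Matrix.det_fin_two]
  field_simp

theorem slope_mul_tor (g : PGL(2, F)) (a : Fˣ) : slope (g * tor a) = slope g := by
  induction g using ProjGenLinGroup.induction_on with | mk h =>
  rw [tor, ← map_mul, slope_mk, slope_mk]
  simp [Matrix.mul_apply, Fin.sum_univ_two, GeneralLinearGroup.mkOfDetNeZero]
  rw [mul_div_mul_right _ _ a.ne_zero]

theorem ratio_tor_inv_mul (g : PGL(2, F)) (a : Fˣ) :
    ratio ((tor a)⁻¹ * g) = (a : F)⁻¹ * ratio g := by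
  obtain ⟨g, rfl⟩ : ∃ g', g = tor a * g' := ⟨(tor a)⁻¹ * g, by group⟩
  rw [inv_mul_cancel_left]
  induction g using ProjGenLinGroup.induction_on with | mk h =>
  have := det_ne_zero' h
  have := a.ne_zero
  rw [tor, ← map_mul, ratio_mk, ratio_mk']
  simp [Matrix.mul_apply, Fin.sum_univ_two, GeneralLinearGroup.mkOfDetNeZero,
    Matrix.det_fin_two]
  field_simp

theorem slope_tor_inv_mul (g : PGL(2, F)) (a : Fˣ) :
    slope ((tor a)⁻¹ * g) = a * slope g := by
  obtain ⟨g, rfl⟩ : ∃ g', g = tor a * g' := ⟨(tor a)⁻¹ * g, by group⟩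
  rw [inv_mul_cancel_left]
  induction g using ProjGenLinGroup.induction_on with | mk h =>
  have := a.ne_zero
  rw [tor, ← map_mul, slope_mk, slope_mk]
  simp [Matrix.mul_apply, Fin.sum_univ_two, GeneralLinearGroup.mkOfDetNeZero]
  field_simp

theorem unip_add (a b : F) : unip (a + b) = unip a * unip b := by
  simp [unip, AddChar.map_add_eq_mul]

theorem unip_neg (a : F) : unip (-a) = (unip a)⁻¹ := by
  rw [unip, unip, AddChar.map_neg_eq_inv, map_inv]

theorem unip_mul_tor (a : Fˣ) (b : F) : unip b * tor a = tor a * unip ((a : F)⁻¹ * b) := by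
  rw [unip, unip, tor, ← map_mul, ← map_mul]
  congr 1
  ext i j
  fin_cases i <;> fin_cases j <;>
    simp [GeneralLinearGroup.upperRightHom, Matrix.mul_apply, Fin.sum_univ_two,
      GeneralLinearGroup.mkOfDetNeZero]

theorem tor_mul (a b : Fˣ) : tor (a * b) = tor a * tor b := by
  rw [tor, tor, tor, ← map_mul]
  congr 1
  ext i j
  fin_cases i <;> fin_cases j <;>
    simp [Matrix.mul_apply, Fin.sum_univ_two, GeneralLinearGroup.mkOfDetNeZero]

theorem tor_one : tor (1 : Fˣ) = 1 := by
  rw [tor, ← ProjGenLinGroup.mk_one]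
  congr 1
  ext i j
  fin_cases i <;> fin_cases j <;> simp [GeneralLinearGroup.mkOfDetNeZero]

/-- The image in `PGL(2, F)` of the lower triangular unipotent matrix `(1, 0; r, 1)`. -/
def lowUnip (r : F) : PGL(2, F) :=
  ProjGenLinGroup.mk (GeneralLinearGroup.mkOfDetNeZero !![1, 0; r, 1] (by simp))

/-- An element with `g₁₁ ≠ 0` is a product of lower unipotent, diagonal and upper unipotent. -/
theorem exists_eq_lowUnip_mul (g : PGL(2, F)) (a : Fˣ) (ha : ratio g = a) :
    ∃ b, g = lowUnip (slope g) * tor a * unip b := by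
  induction g using ProjGenLinGroup.induction_on with | mk h =>
  have hD := det_ne_zero' h
  have ha0 := a.ne_zero
  rw [ratio_mk'] at ha
  have h0 : h 0 0 ≠ 0 := by
    intro h0
    rw [h0] at ha
    simp at ha
    exact ha0 ha.symm
  refine ⟨h 0 1 / h 0 0, ?_⟩
  rw [slope_mk, lowUnip, unip, tor, ← map_mul, ← map_mul, eq_comm, ProjGenLinGroup.mk_eq_mk_iff]
  -- The triangular product has upper left entry `a`, which determines the scalar.
  refine ⟨Units.mk0 ((h 0 0) / a) (div_ne_zero h0 ha0), ?_⟩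
  ext i j
  fin_cases i <;> fin_cases j <;>
    simp [GeneralLinearGroup.upperRightHom, Matrix.mul_apply, Fin.sum_univ_two,
      GeneralLinearGroup.mkOfDetNeZero, Matrix.scalar_apply]
  · field_simp
  · field_simp
  · field_simp
  · rw [div_eq_iff hD] at ha
    field_simp
    linear_combination ha

end Coordinates

/-! ### The groups `Γ_d`, the Iwasawa decomposition and the character `x̃` -/

section Gamma

variable {F : Type*} [Field F] [ValuativeRel F] [TopologicalSpace F]
  [IsNonarchimedeanLocalField F]

theorem mk_mem_Gamma {d : ℕ} (h : GL (Fin 2) F) (h1 : ∀ i j, valuation F (h i j) ≤ 1)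
    (h2 : valuation F (h 0 0 * h 1 1 - h 0 1 * h 1 0) = 1)
    (h3 : valuation F (h 1 0) ≤ pv F ^ d) : ProjGenLinGroup.mk h ∈ Gamma F d := by
  let M : Matrix (Fin 2) (Fin 2) 𝒪[F] := Matrix.of fun i j => ⟨h i j, h1 i j⟩
  have hM : IsUnit M.det := by
    rw [isUnit_integer_iff, ← h2, Matrix.det_fin_two]
    rfl
  refine ⟨GeneralLinearGroup.mk'' M hM, (mem_maximalIdeal_pow_iff _ _).2 h3, ?_⟩
  rw [MonoidHom.comp_apply]
  congr 1
  ext i j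
  rfl

theorem exists_of_mem_Gamma {d : ℕ} {g : PGL(2, F)} (hg : g ∈ Gamma F d) :
    ∃ h : GL (Fin 2) F, ProjGenLinGroup.mk h = g ∧ (∀ i j, valuation F (h i j) ≤ 1) ∧
      valuation F (h 0 0 * h 1 1 - h 0 1 * h 1 0) = 1 ∧ valuation F (h 1 0) ≤ pv F ^ d := by
  obtain ⟨M, hM, rfl⟩ := hg
  refine ⟨_, rfl, fun i j => (M i j).2, ?_, (mem_maximalIdeal_pow_iff _ _).1 hM⟩
  have := (isUnit_integer_iff _).1 ((Matrix.isUnit_iff_isUnit_det _).1 M.isUnit)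
  rw [Matrix.det_fin_two] at this
  exact this

theorem Gamma_anti {m n : ℕ} (h : m ≤ n) : Gamma F n ≤ Gamma F m := by
  intro g hg
  obtain ⟨h, rfl, h1, h2, h3⟩ := exists_of_mem_Gamma hg
  exact mk_mem_Gamma h h1 h2 (h3.trans (pv_pow_anti ‹_›))

theorem valuation_eq_one_of_det {p q r s : F} (hp : valuation F p ≤ 1) (hq : valuation F q ≤ 1)
    (hs : valuation F s ≤ 1) (hr : valuation F r < 1) (hD : valuation F (p * s - q * r) = 1) :
    valuation F p = 1 ∧ valuation F s = 1 := by
  have hqr : valuation F (q * r) < 1 := by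
    rw [map_mul]
    exact (mul_le_of_le_one_left' hq).trans_lt hr
  have hps : valuation F (p * s) = 1 := by
    apply valuation_eq_one_of_sub hD
    rwa [sub_sub_cancel]
  rw [map_mul] at hps
  constructor
  · exact le_antisymm hp (hps.symm.le.trans (mul_le_of_le_one_right' hs))
  · exact le_antisymm hs (hps.symm.le.trans (mul_le_of_le_one_left' hp))

theorem ratio_slope_of_mem_Gamma {d : ℕ} (hd : 0 < d) {g : PGL(2, F)} (hg : g ∈ Gamma F d) :
    valuation F (ratio g) = 1 ∧ valuation F (slope g) ≤ pv F ^ d := by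
  obtain ⟨h, rfl, h1, h2, h3⟩ := exists_of_mem_Gamma hg
  obtain ⟨hp, hs⟩ := valuation_eq_one_of_det (h1 0 0) (h1 0 1) (h1 1 1)
    (h3.trans_lt (pv_pow_lt_one hd)) h2
  rw [ratio_mk', slope_mk, map_div₀, map_div₀, h2, map_pow, hp]
  simpa using h3

/-- A nonzero ratio excludes `g₁₁ = 0`, where `slope` takes the default value `0` and carries no
information. -/
theorem mem_Gamma_of_ratio_slope {d : ℕ} {g : PGL(2, F)} (hg : g ∈ Gamma F 0)
    (hr : ratio g ≠ 0) (hs : valuation F (slope g) ≤ pv F ^ d) : g ∈ Gamma F d := by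
  obtain ⟨h, rfl, h1, h2, -⟩ := exists_of_mem_Gamma hg
  have h0 : h 0 0 ≠ 0 := by
    rintro h0
    rw [ratio_mk', h0] at hr
    simp at hr
  rw [slope_mk, map_div₀, div_le_iff₀ (zero_lt_iff.2 ((valuation F).ne_zero_iff.2 h0))] at hs
  exact mk_mem_Gamma h h1 h2 (hs.trans (mul_le_of_le_one_right' (h1 0 0)))

theorem unip_mem_Gamma {d : ℕ} {b : F} (hb : valuation F b ≤ 1) : unip b ∈ Gamma F d := by
  refine mk_mem_Gamma _ (fun i j => ?_) ?_ ?_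
  · fin_cases i <;> fin_cases j <;> simp [GeneralLinearGroup.upperRightHom, hb]
  · simp [GeneralLinearGroup.upperRightHom]
  · simp [GeneralLinearGroup.upperRightHom]

theorem valuation_le_one_of_unip_mem {d : ℕ} {b : F} (hb : unip b ∈ Gamma F d) :
    valuation F b ≤ 1 := by
  obtain ⟨h, hh, h1, h2, -⟩ := exists_of_mem_Gamma hb
  obtain ⟨z, rfl⟩ := ProjGenLinGroup.mk_eq_mk_iff.1 hh.symm
  have h01 := h1 0 1
  simp [GeneralLinearGroup.upperRightHom, Matrix.mul_apply, Fin.sum_univ_two,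
    Matrix.scalar_apply] at h01 h2
  have hz : valuation F (z : F) = 1 := by
    rw [← sq] at h2
    exact (pow_eq_one_iff_of_nonneg zero_le two_ne_zero).1 h2
  simpa [hz] using h01

theorem lowUnip_mem_Gamma {d : ℕ} {r : F} (hr : valuation F r ≤ pv F ^ d) :
    lowUnip r ∈ Gamma F d := by
  refine mk_mem_Gamma _ (fun i j => ?_) ?_ ?_
  · fin_cases i <;> fin_cases j <;>
      simp [GeneralLinearGroup.mkOfDetNeZero, hr.trans (pv_pow_le_one d)]
  · simp [GeneralLinearGroup.mkOfDetNeZero]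
  · simpa [GeneralLinearGroup.mkOfDetNeZero] using hr

theorem tor_mem_Gamma {d : ℕ} {a : Fˣ} (ha : valuation F (a : F) = 1) : tor a ∈ Gamma F d := by
  refine mk_mem_Gamma _ (fun i j => ?_) ?_ ?_
  · fin_cases i <;> fin_cases j <;> simp [GeneralLinearGroup.mkOfDetNeZero, ha]
  · simp [GeneralLinearGroup.mkOfDetNeZero, ha]
  · simp [GeneralLinearGroup.mkOfDetNeZero]

theorem mem_Gamma_mul_U_iff {d : ℕ} (hd : 0 < d) {g : PGL(2, F)} :
    g ∈ (Gamma F d : Set PGL(2, F)) * (U F : Set PGL(2, F)) ↔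
      valuation F (ratio g) = 1 ∧ valuation F (slope g) ≤ pv F ^ d := by
  constructor
  · rintro ⟨γ, hγ, _, ⟨b, rfl⟩, rfl⟩
    simpa only [ratio_mul_unip, slope_mul_unip] using ratio_slope_of_mem_Gamma hd hγ
  · rintro ⟨h1, h2⟩
    have h0 : ratio g ≠ 0 := by
      intro h0
      simp [h0] at h1
    obtain ⟨b, hb⟩ := exists_eq_lowUnip_mul g (Units.mk0 _ h0) rfl
    rw [hb]
    exact Set.mul_mem_mul (mul_mem (lowUnip_mem_Gamma h2) (tor_mem_Gamma h1)) ⟨b, rfl⟩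

/-- The Iwasawa decomposition of `PGL(2, F)`. -/
theorem exists_iwasawa (g : PGL(2, F)) : ∃ k ∈ Gamma F 0, ∃ (n : ℤ) (b : F),
    g = k * tor (Units.mk0 (unif F) (unif_ne_zero F) ^ n) * unip b := by
  have key : ∀ g : PGL(2, F), ratio g ≠ 0 → valuation F (slope g) ≤ 1 →
      ∃ k ∈ Gamma F 0, ∃ (n : ℤ) (b : F),
        g = k * tor (Units.mk0 (unif F) (unif_ne_zero F) ^ n) * unip b := by
    intro g h0 hs
    obtain ⟨n, hn⟩ := exists_valuation_eq_zpow h0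
    set ϖ := Units.mk0 (unif F) (unif_ne_zero F)
    obtain ⟨b, hb⟩ := exists_eq_lowUnip_mul g (Units.mk0 _ h0) rfl
    -- The unit part of the ratio goes into the compact factor and the power of the uniformizer
    -- remains.
    refine ⟨lowUnip (slope g) * tor (Units.mk0 _ h0 * (ϖ ^ n)⁻¹),
      mul_mem (lowUnip_mem_Gamma (by simpa using hs)) (tor_mem_Gamma ?_), n, b, ?_⟩
    · have : valuation F (ϖ : F) = pv F := rfl
      simp [hn, this]
      exact mul_inv_cancel₀ (zpow_ne_zero _ (pv_ne_zero F))
    · rw [mul_assoc (lowUnip _), ← tor_mul, inv_mul_cancel_right]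
      exact hb
  by_cases hg : ratio g ≠ 0 ∧ valuation F (slope g) ≤ 1
  · exact key g hg.1 hg.2
  -- Exchanging the rows inverts the slope, so it reduces the remaining elements to `key`.
  let w : GL (Fin 2) F := GeneralLinearGroup.mkOfDetNeZero !![0, 1; 1, 0] (by simp)
  have hw : ProjGenLinGroup.mk w ∈ Gamma F 0 := by
    refine mk_mem_Gamma _ (fun i j => ?_) ?_ ?_
    · fin_cases i <;> fin_cases j <;> simp [w, GeneralLinearGroup.mkOfDetNeZero]
    · simp [w, GeneralLinearGroup.mkOfDetNeZero, Valuation.map_neg]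
    · simp [w, GeneralLinearGroup.mkOfDetNeZero]
  have h2 : ratio (ProjGenLinGroup.mk w * g) ≠ 0 ∧
      valuation F (slope (ProjGenLinGroup.mk w * g)) ≤ 1 := by
    induction g using ProjGenLinGroup.induction_on with | mk h =>
    have hD := det_ne_zero' h
    rw [← map_mul, ratio_mk', slope_mk]
    have e : ∀ j, (w * h) 0 j = h 1 j := fun j => by
      simp [w, GeneralLinearGroup.mkOfDetNeZero, Matrix.mul_apply, Fin.sum_univ_two]
    have e' : ∀ j, (w * h) 1 j = h 0 j := fun j => by
      simp [w, GeneralLinearGroup.mkOfDetNeZero, Matrix.mul_apply, Fin.sum_univ_two]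
    simp only [e, e']
    rw [ratio_mk', slope_mk] at hg
    by_cases h0 : h 0 0 = 0
    · have h10 : h 1 0 ≠ 0 := by
        intro h10
        simp [h0, h10] at hD
      refine ⟨div_ne_zero (pow_ne_zero _ h10) ?_, by simp [h0]⟩
      intro hh
      apply hD
      linear_combination -hh
    · have hr : h 0 0 ^ 2 / (h 0 0 * h 1 1 - h 0 1 * h 1 0) ≠ 0 :=
        div_ne_zero (pow_ne_zero _ h0) hD
      have hs : 1 < valuation F (h 1 0 / h 0 0) := by
        by_contra hs
        exact hg ⟨hr, not_lt.1 hs⟩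
      have h10 : h 1 0 ≠ 0 := by
        intro h10
        simp [h10] at hs
      refine ⟨div_ne_zero (pow_ne_zero _ h10) ?_, ?_⟩
      · intro hh
        apply hD
        linear_combination -hh
      · rw [← inv_div, map_inv₀]
        exact inv_le_one_of_one_le₀ hs.le
  obtain ⟨k, hk, n, b, hkb⟩ := key _ h2.1 h2.2
  refine ⟨(ProjGenLinGroup.mk w)⁻¹ * k, mul_mem (inv_mem hw) hk, n, b, ?_⟩
  rw [mul_assoc, mul_assoc, ← mul_assoc k, ← hkb, inv_mul_cancel_left]

variable (x : 𝒪[F]ˣ →ₜ* ℂˣ)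

/-- The ratio is multiplicative up to the square of an element of `1 + 𝓂 ^ d`, and `x ^ 2` is
trivial there. This is what makes `x̃` a character at level `d`. -/
theorem tildeChar_mul (hx : 0 < depth x) {γ g : PGL(2, F)} (hγ : γ ∈ Gamma F (depth x))
    (hg1 : valuation F (ratio g) = 1) (hg : valuation F (slope g) ≤ pv F ^ depth x) :
    tildeChar x (γ * g) = tildeChar x γ * tildeChar x g := by
  have hr := (ratio_slope_of_mem_Gamma hx hγ).1
  obtain ⟨h, rfl, h1, h2, h3⟩ := exists_of_mem_Gamma hγ
  obtain ⟨hp, hs⟩ := valuation_eq_one_of_det (h1 0 0) (h1 0 1) (h1 1 1)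
    (h3.trans_lt (pv_pow_lt_one hx)) h2
  have hp0 : h 0 0 ≠ 0 := by
    intro h0
    simp [h0] at hp
  induction g using ProjGenLinGroup.induction_on with | mk k =>
  have hk0 : k 0 0 ≠ 0 := by
    intro h0
    rw [ratio_mk', h0] at hg1
    simp at hg1
  have e : ratio (ProjGenLinGroup.mk h * ProjGenLinGroup.mk k) =
      (1 + h 0 1 / h 0 0 * slope (ProjGenLinGroup.mk k)) ^ 2 *
      (ratio (ProjGenLinGroup.mk h) * ratio (ProjGenLinGroup.mk k)) := by
    have := det_ne_zero' h
    have := det_ne_zero' k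
    rw [← map_mul, ratio_mk, ratio_mk', ratio_mk', slope_mk, Units.val_mul, Matrix.det_mul,
      Matrix.det_fin_two, Matrix.det_fin_two]
    simp only [Matrix.mul_apply, Fin.sum_univ_two]
    field_simp
  have hv : valuation F (h 0 1 / h 0 0 * slope (ProjGenLinGroup.mk k)) ≤ pv F ^ depth x := by
    rw [map_mul, map_div₀, hp, div_one]
    exact (mul_le_of_le_one_left' (h1 0 1)).trans hg
  have hv1 : valuation F ((1 + h 0 1 / h 0 0 * slope (ProjGenLinGroup.mk k)) ^ 2) = 1 := by
    rw [map_pow, valuation_eq_one_of_sub (map_one (valuation F)), one_pow]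
    rw [add_sub_cancel_left]
    exact hv.trans_lt (pv_pow_lt_one hx)
  rw [tildeChar, e, extChar_mul x hv1, extChar_sq_eq_one x hx (by rwa [add_sub_cancel_left]),
    one_mul, extChar_mul x hr, tildeChar, tildeChar]

end Gamma

/-! ### Topology of `Γ_d`; membership of `phi0` and `f0` -/

section Topology

variable {F : Type*} [Field F] [ValuativeRel F] [TopologicalSpace F]
  [IsNonarchimedeanLocalField F]

theorem continuous_mk : Continuous (ProjGenLinGroup.mk : GL (Fin 2) F → PGL(2, F)) :=
  continuous_quotient_mk'

theorem isOpenMap_mk : IsOpenMap (ProjGenLinGroup.mk : GL (Fin 2) F → PGL(2, F)) :=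
  QuotientGroup.isOpenMap_coe (N := Subgroup.center (GL (Fin 2) F))

theorem nhds_one_eq_map_mk :
    nhds (1 : PGL(2, F)) = Filter.map ProjGenLinGroup.mk (nhds (1 : GL (Fin 2) F)) := by
  refine le_antisymm ?_ ?_
  · simpa using isOpenMap_mk.nhds_le (1 : GL (Fin 2) F)
  · have h : Filter.Tendsto ProjGenLinGroup.mk (nhds (1 : GL (Fin 2) F))
        (nhds (ProjGenLinGroup.mk (1 : GL (Fin 2) F))) :=
      continuous_mk.tendsto 1
    rwa [map_one] at h

theorem continuous_GL_apply (i j : Fin 2) : Continuous fun h : GL (Fin 2) F => h i j :=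
  Units.continuous_val.matrix_elem i j

theorem continuous_GL_det :
    Continuous fun h : GL (Fin 2) F => h 0 0 * h 1 1 - h 0 1 * h 1 0 :=
  ((continuous_GL_apply 0 0).mul (continuous_GL_apply 1 1)).sub
    ((continuous_GL_apply 0 1).mul (continuous_GL_apply 1 0))

theorem continuous_mkOfDetNeZero {X : Type*} [TopologicalSpace X]
    (M : X → Matrix (Fin 2) (Fin 2) F) (hM : ∀ t, (M t).det ≠ 0) (hc : Continuous M) :
    Continuous fun t => GeneralLinearGroup.mkOfDetNeZero (M t) (hM t) := by
  rw [Units.continuous_iff]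
  refine ⟨hc, ?_⟩
  have : ∀ t, ((GeneralLinearGroup.mkOfDetNeZero (M t) (hM t))⁻¹ : GL (Fin 2) F).1 =
      (M t).det⁻¹ • (M t).adjugate := by
    intro t
    rw [GeneralLinearGroup.coe_inv, Matrix.inv_def, Ring.inverse_eq_inv']
    rfl
  simp only [this]
  exact (hc.matrix_det.inv₀ hM).smul hc.matrix_adjugate

theorem continuous_lowUnip : Continuous (lowUnip : F → PGL(2, F)) := by
  refine continuous_mk.comp (continuous_mkOfDetNeZero _ _ ?_)
  refine continuous_matrix fun i j => ?_
  fin_cases i <;> fin_cases j <;> simp <;> fun_prop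

theorem eventually_valuation_le {X : Type*} [TopologicalSpace X] {f : X → F} {t : X}
    (hf : ContinuousAt f t) (n : ℕ) :
    ∀ᶠ s in nhds t, valuation F (f s - f t) ≤ pv F ^ n := by
  have hg : ContinuousAt (fun s => f s - f t) t := hf.sub continuousAt_const
  refine hg.eventually_mem ((isOpen_valuation_le (pow_ne_zero n (pv_ne_zero F))).mem_nhds ?_)
  simp

theorem isOpen_Gamma (d : ℕ) : IsOpen (Gamma F d : Set PGL(2, F)) := by
  apply Subgroup.isOpen_of_mem_nhds _ (g := 1)
  rw [nhds_one_eq_map_mk, Filter.mem_map]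
  have he : ∀ᶠ h in nhds (1 : GL (Fin 2) F), ∀ i j, valuation F (h i j) ≤ 1 := by
    rw [Filter.eventually_all]
    intro i
    rw [Filter.eventually_all]
    intro j
    refine (continuous_GL_apply i j).continuousAt.eventually_mem
      ((isOpen_valuation_le one_ne_zero).mem_nhds ?_)
    fin_cases i <;> fin_cases j <;> simp
  filter_upwards [he, eventually_valuation_le (continuous_GL_apply 1 0).continuousAt d,
    eventually_valuation_le continuous_GL_det.continuousAt 1] with h h1 h2 h3
  refine mk_mem_Gamma h h1 (valuation_eq_one_of_sub (a := 1) (map_one _) ?_) ?_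
  · rw [pow_one] at h3
    simpa using h3.trans_lt pv_lt_one
  · simpa using h2

theorem isCompact_Gamma_zero : IsCompact (Gamma F 0 : Set PGL(2, F)) := by
  have : CompactSpace (Matrix (Fin 2) (Fin 2) 𝒪[F]) :=
    inferInstanceAs (CompactSpace (Fin 2 → Fin 2 → 𝒪[F]))
  have : T1Space (Matrix (Fin 2) (Fin 2) 𝒪[F]) :=
    inferInstanceAs (T1Space (Fin 2 → Fin 2 → 𝒪[F]))
  have : CompactSpace (GL (Fin 2) 𝒪[F]) :=
    inferInstanceAs (CompactSpace (Matrix (Fin 2) (Fin 2) 𝒪[F])ˣ)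
  have hv : Continuous fun g : GL (Fin 2) 𝒪[F] =>
      (GeneralLinearGroup.map (algebraMap 𝒪[F] F) g : Matrix (Fin 2) (Fin 2) F) :=
    continuous_matrix fun i j =>
      continuous_subtype_val.comp (Units.continuous_val.matrix_elem i j)
  have hc : Continuous (GeneralLinearGroup.map (n := Fin 2) (algebraMap 𝒪[F] F)) := by
    refine Units.continuous_iff.2 ⟨hv, ?_⟩
    exact hv.comp continuous_inv
  have h0 : GammaTilde F 0 = ⊤ := by
    rw [eq_top_iff]
    intro g _
    change g 1 0 ∈ 𝓂[F] ^ 0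
    simp
  rw [Gamma, h0, Subgroup.coe_map, MonoidHom.coe_comp, Subgroup.coe_top, Set.image_comp]
  exact (isCompact_univ.image hc).image continuous_mk

theorem isClosed_Gamma (d : ℕ) : IsClosed (Gamma F d : Set PGL(2, F)) :=
  Subgroup.isClosed_of_isOpen _ (isOpen_Gamma d)

theorem isCompact_Gamma (d : ℕ) : IsCompact (Gamma F d : Set PGL(2, F)) :=
  isCompact_Gamma_zero.of_isClosed_subset (isClosed_Gamma d) (Gamma_anti (Nat.zero_le d))

theorem isLocallyConstant_of_left_invariant {G Y : Type*} [Group G] [TopologicalSpace G]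
    [IsTopologicalGroup G] {f : G → Y} {S : Set G} (hS : S ∈ nhds 1)
    (hf : ∀ s ∈ S, ∀ g, f (s * g) = f g) : IsLocallyConstant f := by
  rw [IsLocallyConstant.iff_eventually_eq]
  intro g
  have hc : Filter.Tendsto (fun h : G => h * g⁻¹) (nhds g) (nhds 1) := by
    have := (continuous_mul_const g⁻¹).tendsto g
    rwa [mul_inv_cancel] at this
  filter_upwards [hc hS] with h hh
  simpa using hf _ hh g

variable (x : 𝒪[F]ˣ →ₜ* ℂˣ)

theorem ratio_one : ratio (1 : PGL(2, F)) = 1 := by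
  rw [← ProjGenLinGroup.mk_one, ratio_mk']
  simp

/-- The ratio is continuous and `x` is trivial near `1`. Functions that are `x̃`-equivariant on the
left are therefore locally constant. -/
theorem eventually_tildeChar_eq_one (hx : 0 < depth x) :
    {γ : PGL(2, F) | γ ∈ Gamma F (depth x) ∧ tildeChar x γ = 1} ∈ nhds 1 := by
  have h2 : {γ : PGL(2, F) | tildeChar x γ = 1} ∈ nhds 1 := ?_
  · exact Filter.inter_mem ((isOpen_Gamma _).mem_nhds (one_mem _)) h2
  rw [nhds_one_eq_map_mk, Filter.mem_map]
  obtain ⟨n, hn⟩ := exists_extChar_eq_one x hx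
  have hc : Continuous fun h : GL (Fin 2) F => ratio (ProjGenLinGroup.mk h) := by
    simp only [ratio_mk']
    exact ((continuous_GL_apply 0 0).pow 2).div continuous_GL_det det_ne_zero'
  filter_upwards [eventually_valuation_le (hc.continuousAt (x := 1)) n] with h hh
  refine hn _ ?_
  simpa [ratio_one] using hh

theorem tildeChar_ne_zero (hx : 0 < depth x) {γ : PGL(2, F)} (hγ : γ ∈ Gamma F (depth x)) :
    tildeChar x γ ≠ 0 :=
  extChar_ne_zero x (ratio_slope_of_mem_Gamma hx hγ).1

theorem tildeChar_mul_of_mem (hx : 0 < depth x) {γ γ' : PGL(2, F)}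
    (hγ : γ ∈ Gamma F (depth x)) (hγ' : γ' ∈ Gamma F (depth x)) :
    tildeChar x (γ * γ') = tildeChar x γ * tildeChar x γ' :=
  tildeChar_mul x hx hγ (ratio_slope_of_mem_Gamma hx hγ').1 (ratio_slope_of_mem_Gamma hx hγ').2

theorem tildeChar_one : tildeChar x (1 : PGL(2, F)) = 1 := by
  rw [tildeChar, ratio_one, extChar_one]

theorem tildeChar_inv (hx : 0 < depth x) {γ : PGL(2, F)} (hγ : γ ∈ Gamma F (depth x)) :
    tildeChar x γ⁻¹ = (tildeChar x γ)⁻¹ := by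
  rw [← mul_eq_one_iff_eq_inv₀ (tildeChar_ne_zero x hx hγ),
    ← tildeChar_mul_of_mem x hx (inv_mem hγ) hγ, inv_mul_cancel, tildeChar_one]

theorem phi0_of_mem {γ : PGL(2, F)} (hγ : γ ∈ Gamma F (depth x)) :
    phi0 x γ = tildeChar x γ := Set.indicator_of_mem hγ _

theorem phi0_of_notMem {g : PGL(2, F)} (hg : g ∉ Gamma F (depth x)) :
    phi0 x g = 0 := Set.indicator_of_notMem hg _

theorem phi0_mul_left (hx : 0 < depth x) {γ : PGL(2, F)} (hγ : γ ∈ Gamma F (depth x))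
    (g : PGL(2, F)) : phi0 x (γ * g) = tildeChar x γ * phi0 x g := by
  by_cases hg : g ∈ Gamma F (depth x)
  · rw [phi0_of_mem x hg, phi0_of_mem x (mul_mem hγ hg), tildeChar_mul_of_mem x hx hγ hg]
  · rw [phi0_of_notMem x hg, phi0_of_notMem, mul_zero]
    rwa [Subgroup.mul_mem_cancel_left _ hγ]

theorem phi0_mul_right (hx : 0 < depth x) {γ : PGL(2, F)} (hγ : γ ∈ Gamma F (depth x))
    (g : PGL(2, F)) : phi0 x (g * γ) = tildeChar x γ * phi0 x g := by
  by_cases hg : g ∈ Gamma F (depth x)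
  · rw [phi0_of_mem x hg, phi0_of_mem x (mul_mem hg hγ), tildeChar_mul_of_mem x hx hg hγ, mul_comm]
  · rw [phi0_of_notMem x hg, phi0_of_notMem, mul_zero]
    rwa [Subgroup.mul_mem_cancel_right _ hγ]

theorem phi0_mem (hx : 0 < depth x) : phi0 x ∈ (W x).toSubmodule := by
  refine ⟨isLocallyConstant_of_left_invariant (eventually_tildeChar_eq_one x hx) ?_, ?_, ?_⟩
  · rintro γ ⟨h1, h2⟩ g
    rw [phi0_mul_left x hx h1, h2, one_mul]
  · exact HasCompactSupport.intro' (isCompact_Gamma _) (isClosed_Gamma _)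
      fun g hg => phi0_of_notMem x hg
  · exact fun g γ hγ => phi0_mul_right x hx hγ g

open scoped Classical in
/-- The function supported on `Γ_m U` and equal to `x̃` there. -/
def fAux (m : ℕ) (g : PGL(2, F)) : ℂ :=
  if valuation F (slope g) ≤ pv F ^ m then extChar x (ratio g) else 0

theorem f0_eq_fAux (hx : 0 < depth x) : f0 x = fAux x (depth x) := by
  funext g
  rw [f0, fAux]
  by_cases hg : g ∈ (Gamma F (depth x) : Set PGL(2, F)) * (U F : Set PGL(2, F))
  · rw [Set.indicator_of_mem hg, if_pos ((mem_Gamma_mul_U_iff hx).1 hg).2, tildeChar]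
  · rw [Set.indicator_of_notMem hg]
    split_ifs with h
    · rw [extChar_eq_zero]
      exact fun h' => hg ((mem_Gamma_mul_U_iff hx).2 ⟨h', h⟩)
    · rfl

theorem f0_mul_left (hx : 0 < depth x) {γ : PGL(2, F)} (hγ : γ ∈ Gamma F (depth x))
    (g : PGL(2, F)) : f0 x (γ * g) = tildeChar x γ * f0 x g := by
  by_cases hg : g ∈ (Gamma F (depth x) : Set PGL(2, F)) * (U F : Set PGL(2, F))
  · obtain ⟨γ', hγ', u, hu, rfl⟩ := hg
    change f0 x (γ * (γ' * u)) = _ * f0 x (γ' * u)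
    rw [← mul_assoc, f0_mul x (mul_mem hγ hγ') hu, f0_mul x hγ' hu, tildeChar_mul_of_mem x hx hγ hγ']
  · rw [f0, Set.indicator_of_notMem hg, Set.indicator_of_notMem, mul_zero]
    rintro ⟨γ', hγ', u, hu, h⟩
    refine hg ⟨γ⁻¹ * γ', mul_mem (inv_mem hγ) hγ', u, hu, ?_⟩
    simp only [mul_assoc] at h ⊢
    rw [h, inv_mul_cancel_left]

theorem f0_mem (hx : 0 < depth x) : f0 x ∈ (V x).toSubmodule := by
  refine ⟨isLocallyConstant_of_left_invariant (eventually_tildeChar_eq_one x hx) ?_, ?_, ?_⟩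
  · rintro γ ⟨h1, h2⟩ g
    rw [f0_mul_left x hx h1, h2, one_mul]
  · exact ⟨_, isCompact_Gamma (depth x), Set.support_indicator_subset⟩
  · rintro g a _ ⟨b, rfl⟩
    rw [f0_eq_fAux x hx, fAux, fAux, slope_mul_unip, slope_mul_tor, ratio_mul_unip, ratio_mul_tor]
    split_ifs
    · rw [extChar_mul x, ← extChar_coe]
      · rfl
      · exact exists_unit_coe_eq_iff.1 ⟨a, rfl⟩
    · rw [mul_zero]

end Topology

/-! ### Spans of left translates -/

section Span

variable {G : Type*} [Group G]

/-- The span of the left translates of a function on a group. -/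
def translateSpan (f : G → ℂ) : Submodule ℂ (G → ℂ) :=
  Submodule.span ℂ (Set.range fun g => leftShift G g f)

theorem leftShift_mem_translateSpan (f : G → ℂ) (g : G) :
    leftShift G g f ∈ translateSpan f := Submodule.subset_span ⟨g, rfl⟩

theorem self_mem_translateSpan (f : G → ℂ) : f ∈ translateSpan f := by
  simpa using leftShift_mem_translateSpan f 1

theorem translateSpan_le {f f' : G → ℂ} (h : f' ∈ translateSpan f) :
    translateSpan f' ≤ translateSpan f := by
  refine Submodule.span_le.2 ?_
  rintro _ ⟨g, rfl⟩
  have : translateSpan f ≤ (translateSpan f).comap (leftShift G g) := by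
    refine Submodule.span_le.2 ?_
    rintro _ ⟨g', rfl⟩
    change leftShift G g (leftShift G g' f) ∈ translateSpan f
    rw [← Module.End.mul_apply, ← map_mul]
    exact leftShift_mem_translateSpan f _
  exact this h

end Span

/-! ### Passing from `f_m` to `f_(m+1)` by averaging over `U` -/

section Generation

variable {F : Type*} [Field F] [ValuativeRel F] [TopologicalSpace F]
  [IsNonarchimedeanLocalField F]

/-- Affine substitutions permute the residue classes. -/
theorem sum_residue_affine [Fintype 𝓀[F]] (s : 𝓀[F] → 𝒪[F])
    (hs : ∀ c, IsLocalRing.residue 𝒪[F] (s c) = c) (ψ : 𝒪[F] → ℂ)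
    (hψ : ∀ b b', b - b' ∈ 𝓂[F] → ψ b = ψ b') (u : 𝒪[F]) (hu : IsUnit u) (e : 𝒪[F]) :
    ∑ c, ψ (u * s c + e) = ∑ c, ψ (s c) := by
  have hu' : IsLocalRing.residue 𝒪[F] u ≠ 0 := by
    rw [IsLocalRing.residue_ne_zero_iff_isUnit]
    exact hu
  refine Fintype.sum_equiv ((Equiv.mulLeft₀ _ hu').trans
    (Equiv.addRight (IsLocalRing.residue 𝒪[F] e))) _ _ fun c => hψ _ _ ?_
  rw [← IsLocalRing.residue_eq_zero_iff]
  simp [hs]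

theorem ratio_unip_mul {g : PGL(2, F)} (hg : ratio g ≠ 0) (b : F) :
    ratio (unip b * g) = (1 + b * slope g) ^ 2 * ratio g := by
  induction g using ProjGenLinGroup.induction_on with | mk h =>
  have h0 : h 0 0 ≠ 0 := by
    rintro h0
    rw [ratio_mk', h0] at hg
    simp at hg
  have := det_ne_zero' h
  rw [unip, ← map_mul, ratio_mk, ratio_mk', slope_mk, Units.val_mul, Matrix.det_mul,
    Matrix.det_fin_two (h : Matrix (Fin 2) (Fin 2) F)]
  simp [GeneralLinearGroup.upperRightHom, Matrix.mul_apply, Fin.sum_univ_two]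
  field_simp

/-- If `1 + b * slope g = 0`, the new upper left entry vanishes, and both sides are `0` by the
convention for division. -/
theorem slope_unip_mul {g : PGL(2, F)} (hg : ratio g ≠ 0) (b : F) :
    slope (unip b * g) = slope g / (1 + b * slope g) := by
  induction g using ProjGenLinGroup.induction_on with | mk h =>
  have h0 : h 0 0 ≠ 0 := by
    rintro h0
    rw [ratio_mk', h0] at hg
    simp at hg
  rw [unip, ← map_mul, slope_mk, slope_mk]
  simp [GeneralLinearGroup.upperRightHom, Matrix.mul_apply, Fin.sum_univ_two]
  field_simp

variable (x : 𝒪[F]ˣ →ₜ* ℂˣ)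

theorem fAux_ne_zero_iff (m : ℕ) (g : PGL(2, F)) :
    fAux x m g ≠ 0 ↔ valuation F (slope g) ≤ pv F ^ m ∧ valuation F (ratio g) = 1 := by
  rw [fAux]
  constructor
  · intro h
    split_ifs at h with h1
    · exact ⟨h1, valuation_eq_one_of_extChar_ne_zero x h⟩
    · exact absurd rfl h
  · rintro ⟨h1, h2⟩
    rw [if_pos h1]
    exact extChar_ne_zero x h2

/-- On the support of `f_m`, the factor `1 + b * slope g` lies in `1 + 𝓂 ^ d`. It leaves the
valuation of the slope alone and changes the ratio by a square on which `x` is trivial. -/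
theorem fAux_unip_mul_of_ne_zero (hx : 0 < depth x) {m : ℕ} {g : PGL(2, F)} {b : F}
    (hb : valuation F b * pv F ^ m ≤ pv F ^ depth x) (hg : fAux x m g ≠ 0) :
    fAux x m (unip b * g) = fAux x m g := by
  obtain ⟨h1, h2⟩ := (fAux_ne_zero_iff x m g).1 hg
  have h0 : ratio g ≠ 0 := (valuation F).ne_zero_iff.1 (by rw [h2]; exact one_ne_zero)
  have hv : valuation F (1 + b * slope g - 1) ≤ pv F ^ depth x := by
    rw [add_sub_cancel_left, map_mul]
    exact (mul_le_mul_right h1 _).trans hb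
  have hv1 : valuation F (1 + b * slope g) = 1 :=
    valuation_eq_one_of_sub (map_one _) (hv.trans_lt (pv_pow_lt_one hx))
  rw [fAux, fAux, slope_unip_mul h0, ratio_unip_mul h0, map_div₀, hv1, div_one, if_pos h1,
    if_pos h1, extChar_mul x (by rw [map_pow, hv1, one_pow]), extChar_sq_eq_one x hx hv, one_mul]

theorem fAux_unip_mul (hx : 0 < depth x) {m : ℕ} (g : PGL(2, F)) {b : F}
    (hb : valuation F b * pv F ^ m ≤ pv F ^ depth x) :
    fAux x m (unip b * g) = fAux x m g := by
  by_cases hg : fAux x m g = 0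
  · by_contra h
    have := fAux_unip_mul_of_ne_zero x hx (b := -b) (by rwa [Valuation.map_neg])
      (fun h' => h (h'.trans hg.symm))
    rw [unip_neg, inv_mul_cancel_left] at this
    exact h this.symm
  · exact fAux_unip_mul_of_ne_zero x hx hb hg

theorem fAux_succ_eq_of_ne_zero {m : ℕ} {g : PGL(2, F)} (hg : fAux x (m + 1) g ≠ 0) :
    fAux x m g = fAux x (m + 1) g := by
  obtain ⟨h1, h2⟩ := (fAux_ne_zero_iff x _ g).1 hg
  rw [fAux, fAux, if_pos h1, if_pos (h1.trans (pv_pow_anti m.le_succ))]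

/-- Summing `f_m` over the translates by a system of representatives of `𝓂^(d-1-m) / 𝓂^(d-m)`
in `U` gives a multiple of `f_(m+1)`. -/
theorem sum_fAux_unip [Fintype 𝓀[F]] (hx : 0 < depth x) {m : ℕ} (s : 𝓀[F] → 𝒪[F])
    (hs : ∀ c, IsLocalRing.residue 𝒪[F] (s c) = c) (g : PGL(2, F)) {κ : F}
    (hκ : valuation F κ * pv F ^ m = pv F ^ (depth x - 1)) :
    ∑ c, fAux x m (unip (κ * s c) * g) = Fintype.card 𝓀[F] * fAux x (m + 1) g := by
  have hpd : pv F ^ (depth x - 1) * pv F = pv F ^ depth x := by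
    rw [← pow_succ, Nat.sub_add_cancel hx]
  have hκ0 : κ ≠ 0 := by
    rintro rfl
    rw [map_zero, zero_mul] at hκ
    exact pow_ne_zero _ (pv_ne_zero F) hκ.symm
  -- The translations by `κ 𝒪` used in the sum fix `f_(m+1)`, since its slopes are smaller by one
  -- more power of the uniformizer.
  have hinv : ∀ b : 𝒪[F], ∀ g, fAux x (m + 1) (unip (κ * b) * g) = fAux x (m + 1) g := by
    intro b g
    apply fAux_unip_mul x hx
    rw [map_mul, pow_succ, ← hpd, ← hκ]
    calc _ = valuation F b * (valuation F κ * pv F ^ m * pv F) := by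
          simp only [mul_comm, mul_left_comm, mul_assoc]
      _ ≤ _ := mul_le_of_le_one_left' b.2
  by_cases hg : fAux x (m + 1) g = 0
  · rw [hg, mul_zero]
    by_contra hsum
    obtain ⟨c₀, -, hc₀⟩ := Finset.exists_ne_zero_of_sum_ne_zero hsum
    set g₀ := unip (κ * s c₀) * g with hg₀
    have hg1 : fAux x (m + 1) g₀ = 0 := (hinv _ _).trans hg
    obtain ⟨h1, h2⟩ := (fAux_ne_zero_iff x m g₀).1 hc₀
    have h0 : ratio g₀ ≠ 0 := (valuation F).ne_zero_iff.1 (by rw [h2]; exact one_ne_zero)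
    set σ := slope g₀ with hσ
    -- The term at `c₀` is nonzero although `f_(m+1)` vanishes there, so the slope lies in `𝓂 ^ m`
    -- but not in `𝓂 ^ (m+1)`.
    have hσv : valuation F σ = pv F ^ m := by
      refine le_antisymm h1 (not_lt.1 fun hlt => ?_)
      refine (fAux_ne_zero_iff x (m + 1) g₀).2 ⟨?_, h2⟩ hg1
      rw [← hσ, pow_succ']
      have : valuation F (σ / unif F ^ m) < 1 := by
        rw [map_div₀, map_pow]
        exact (div_lt_one₀ (pow_pos (pv_pos F) m)).2 hlt
      rw [← le_pv_iff_lt_one, map_div₀, map_pow] at this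
      exact (div_le_iff₀ (pow_pos (pv_pos F) m)).1 this
    have hκσ : valuation F (κ * σ) = pv F ^ (depth x - 1) := by rw [map_mul, hσv, hκ]
    have hκσ0 : κ * σ ≠ 0 := (valuation F).ne_zero_iff.1 (by
      rw [hκσ]; exact pow_ne_zero _ (pv_ne_zero F))
    let ψ : 𝒪[F] → ℂ := fun b => fAux x m (unip (κ * b) * g₀)
    have hψ : ∀ b : 𝒪[F], ψ b = extChar x ((1 + κ * b * σ) ^ 2 * ratio g₀) := by
      intro b
      change fAux x m _ = _
      rw [fAux, slope_unip_mul h0, ratio_unip_mul h0, ← hσ]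
      by_cases hu : valuation F (1 + κ * b * σ) = 1
      · rw [map_div₀, hu, div_one, if_pos h1]
      · rw [extChar_eq_zero, ite_self]
        rw [map_mul, h2, mul_one, map_pow]
        exact fun h => hu ((pow_eq_one_iff_of_nonneg zero_le two_ne_zero).1 h)
    have hψ' : ∀ b b', b - b' ∈ 𝓂[F] → ψ b = ψ b' := by
      intro b b' hbb
      have hbb' : valuation F ((b : F) - b') ≤ pv F := by
        have := mem_maximalIdeal_pow_iff (b - b') 1
        rw [pow_one, pow_one] at this
        simpa using this.1 hbb
      have : unip (κ * b) * g₀ = unip (κ * (b - b')) * (unip (κ * b') * g₀) := by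
        rw [← mul_assoc (unip (κ * (b - b'))), ← unip_add, mul_sub, sub_add_cancel]
      change fAux x m _ = fAux x m _
      rw [this]
      apply fAux_unip_mul x hx
      rw [map_mul, ← hpd, ← hκ, mul_right_comm]
      exact mul_le_mul_right hbb' _
    obtain ⟨c, hc1, hc2, hc3⟩ := exists_extChar_sq_ne_one x hx
    have hz := exists_unit_coe_eq_iff.2 hc2
    obtain ⟨z, hz⟩ := hz
    have he : valuation F (c / (κ * σ)) ≤ 1 := by
      rw [map_div₀, hκσ]
      exact (div_le_one₀ (pow_pos (pv_pos F) _)).2 hc1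
    -- The substitution `b ↦ (1 + c) b + c / (κσ)` multiplies `1 + κσb` by `1 + c`. It permutes
    -- residue classes and multiplies `ψ` by `x((1 + c) ^ 2) ≠ 1`, so the sum of `ψ` is zero.
    have hmul : ∀ b : 𝒪[F], extChar x ((1 + c) ^ 2) * ψ b =
        ψ (z * b + ⟨c / (κ * σ), he⟩) := by
      intro b
      rw [hψ, hψ, ← extChar_mul x (by rw [map_pow, hc2, one_pow])]
      congr 1
      rw [← mul_assoc, ← mul_pow]
      congr 2
      rw [Subring.coe_add, Subring.coe_mul, hz]
      have hκ0 := hκ0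
      have hσ0 : σ ≠ 0 := right_ne_zero_of_mul hκσ0
      field_simp
      ring
    have hzero : ∑ c, ψ (s c) = 0 := by
      have h := sum_residue_affine s hs ψ hψ' z z.isUnit ⟨c / (κ * σ), he⟩
      rw [Finset.sum_congr rfl fun c _ => (hmul (s c)).symm, ← Finset.mul_sum] at h
      by_contra hne
      exact hc3 (mul_right_cancel₀ hne (h.trans (one_mul _).symm))
    apply hsum
    -- A shift by `s c₀` recentres the sum from `g₀` to `g`.
    rw [← hzero, ← sum_residue_affine s hs ψ hψ' 1 isUnit_one (-(s c₀))]
    refine Finset.sum_congr rfl fun c _ => ?_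
    change _ = fAux x m _
    rw [hg₀, ← mul_assoc, ← unip_add]
    congr 3
    push_cast
    ring
  · have : ∀ c, fAux x m (unip (κ * s c) * g) = fAux x (m + 1) g := by
      intro c
      rw [← hinv (s c) g] at hg ⊢
      exact fAux_succ_eq_of_ne_zero x hg
    simp [this]

theorem fAux_succ_mem_translateSpan (hx : 0 < depth x) (m : ℕ) :
    fAux x (m + 1) ∈ translateSpan (fAux x m) := by
  have : Fintype 𝓀[F] := Fintype.ofFinite _
  obtain ⟨s, hs⟩ := (IsLocalRing.residue_surjective (R := 𝒪[F])).hasRightInverse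
  -- A quotient, since the exponent `d - 1 - m` may be negative.
  let κ : F := unif F ^ (depth x - 1) / unif F ^ m
  have hκ : valuation F κ * pv F ^ m = pv F ^ (depth x - 1) := by
    rw [map_div₀, map_pow, map_pow]
    exact div_mul_cancel₀ _ (pow_ne_zero _ (pv_ne_zero F))
  have hq : (Fintype.card 𝓀[F] : ℂ) ≠ 0 := Nat.cast_ne_zero.2 Fintype.card_ne_zero
  have : fAux x (m + 1) = (Fintype.card 𝓀[F] : ℂ)⁻¹ •
      ∑ c, leftShift PGL(2, F) (unip (κ * s c))⁻¹ (fAux x m) := by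
    funext g
    rw [Pi.smul_apply, Finset.sum_apply]
    simp only [leftShift_apply, inv_inv]
    rw [sum_fAux_unip x hx s hs g hκ, smul_eq_mul, inv_mul_cancel_left₀ hq]
  rw [this]
  exact Submodule.smul_mem _ _ (Submodule.sum_mem _ fun c _ => leftShift_mem_translateSpan _ _)

theorem fAux_mem_translateSpan (hx : 0 < depth x) {m : ℕ} (hm : depth x ≤ m) :
    fAux x m ∈ translateSpan (f0 x) := by
  rw [f0_eq_fAux x hx]
  induction m, hm using Nat.le_induction with
  | base => exact self_mem_translateSpan _
  | succ m _ ih => exact translateSpan_le ih (fAux_succ_mem_translateSpan x hx m)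

end Generation

/-! ### `phi0` generates `W x` and `f0` generates `V x` -/

section Generation

variable {F : Type*} [Field F] [ValuativeRel F] [TopologicalSpace F]
  [IsNonarchimedeanLocalField F] (x : 𝒪[F]ˣ →ₜ* ℂˣ)

theorem finite_image_mk_of_isCompact {G : Type*} [Group G] [TopologicalSpace G]
    [IsTopologicalGroup G] {H : Subgroup G} (hH : IsOpen (H : Set G)) {C : Set G}
    (hC : IsCompact C) : ((fun g : G => (g : G ⧸ H)) '' C).Finite := by
  have := QuotientGroup.discreteTopology hH
  exact (hC.image continuous_quotient_mk').finite_of_discrete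

/-- By equivariance `φ` is determined by its values at representatives of the finitely many cosets
of `Γ_d` that meet its support, and the translates of `phi0` are supported on single cosets. -/
theorem W_le_translateSpan :
    (W x).toSubmodule ≤ translateSpan (phi0 x) := by
  rintro φ ⟨-, h2, h3⟩
  have hfin := finite_image_mk_of_isCompact (isOpen_Gamma (F := F) (depth x)) h2.isCompact
  have key : φ = ∑ c ∈ hfin.toFinset, φ c.out • leftShift PGL(2, F) c.out (phi0 x) := by
    funext g
    have hg : (g : PGL(2, F) ⧸ Gamma F (depth x)).out⁻¹ * g ∈ Gamma F (depth x) := by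
      rw [← QuotientGroup.eq, QuotientGroup.out_eq']
    have hz : ∀ c : PGL(2, F) ⧸ Gamma F (depth x), c ≠ g →
        (φ c.out • leftShift PGL(2, F) c.out (phi0 x)) g = 0 := by
      intro c hc
      rw [Pi.smul_apply, leftShift_apply, phi0_of_notMem, smul_zero]
      intro h
      apply hc
      rw [← QuotientGroup.eq, QuotientGroup.out_eq'] at h
      exact h
    have h1 : (φ (g : PGL(2, F) ⧸ Gamma F (depth x)).out •
        leftShift PGL(2, F) (g : PGL(2, F) ⧸ Gamma F (depth x)).out (phi0 x)) g = φ g := by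
      rw [Pi.smul_apply, leftShift_apply, phi0_of_mem x hg, smul_eq_mul, mul_comm, ← h3 _ _ hg,
        mul_inv_cancel_left]
    rw [Finset.sum_apply]
    by_cases hgT : (g : PGL(2, F) ⧸ Gamma F (depth x)) ∈ hfin.toFinset
    · rw [Finset.sum_eq_single_of_mem _ hgT fun c _ hc => hz c hc, h1]
    · rw [Finset.sum_eq_zero]
      · by_contra h
        exact hgT (hfin.mem_toFinset.2 ⟨g, subset_tsupport _ h, rfl⟩)
      · intro c hc
        refine hz c ?_
        rintro rfl
        exact hgT hc
  rw [key]
  exact Submodule.sum_mem _ fun c _ =>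
    Submodule.smul_mem _ _ (leftShift_mem_translateSpan _ _)

/-- Factor `γ` as lower unipotent, diagonal, upper unipotent. The last two factors move past `tor a`
and act through the equivariance of `f`; the first is close to `1`, where local constancy applies.
-/
theorem exists_level_local (hx : 0 < depth x) {f : PGL(2, F) → ℂ} (hf : f ∈ (V x).toSubmodule)
    (k : PGL(2, F)) (a : Fˣ) : ∃ M, depth x ≤ M ∧ ∀ γ ∈ Gamma F M,
      f (k * γ * tor a) = tildeChar x γ * f (k * tor a) := by
  obtain ⟨h1, -, h3⟩ := hf
  have hc : Continuous fun r : F => k * lowUnip r * tor a :=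
    (continuous_lowUnip.const_mul k).mul_const _
  have h0 : lowUnip (0 : F) = 1 := by
    rw [lowUnip, ← ProjGenLinGroup.mk_one]
    congr 1
    ext i j
    fin_cases i <;> fin_cases j <;> simp [GeneralLinearGroup.mkOfDetNeZero]
  have hev := (h1.comp_continuous hc).eventually_eq 0
  obtain ⟨M, hM⟩ := exists_pow_subset_of_mem_nhds_zero hev
  refine ⟨max M (depth x), le_max_right _ _, fun γ hγ => ?_⟩
  obtain ⟨hr, hs⟩ := ratio_slope_of_mem_Gamma (lt_max_of_lt_right hx) hγ
  obtain ⟨u, hu⟩ := exists_unit_coe_eq_iff.2 hr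
  obtain ⟨b, hb⟩ := exists_eq_lowUnip_mul γ (Units.map (algebraMap 𝒪[F] F).toMonoidHom u) hu.symm
  have e : k * γ * tor a = k * lowUnip (slope γ) * tor a *
      tor (Units.map (algebraMap 𝒪[F] F).toMonoidHom u) * unip ((a : F)⁻¹ * b) := by
    conv_lhs => rw [hb]
    rw [mul_assoc k, mul_assoc _ (unip b), unip_mul_tor]
    simp only [← mul_assoc]
    rw [mul_assoc _ _ (tor a), ← tor_mul, mul_comm _ a, tor_mul]
    simp only [← mul_assoc]
  have hM' := hM _ (hs.trans (pv_pow_anti (le_max_left _ _)))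
  simp only [Set.mem_ofPred_eq, Function.comp_apply, h0, mul_one] at hM'
  rw [e, h3 _ _ _ ⟨_, rfl⟩, hM', tildeChar, ← hu, extChar_coe]

/-- Compactness of `K` makes the level uniform in `k`. -/
theorem exists_level (hx : 0 < depth x) {f : PGL(2, F) → ℂ} (hf : f ∈ (V x).toSubmodule)
    (a : Fˣ) : ∃ M, depth x ≤ M ∧ ∀ k ∈ Gamma F 0, ∀ γ ∈ Gamma F M,
      f (k * γ * tor a) = tildeChar x γ * f (k * tor a) := by
  refine isCompact_Gamma_zero.induction_on (p := fun S : Set PGL(2, F) => ∃ M, depth x ≤ M ∧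
    ∀ k ∈ S, ∀ γ ∈ Gamma F M, f (k * γ * tor a) = tildeChar x γ * f (k * tor a)) ?_ ?_ ?_ ?_
  · exact ⟨depth x, le_rfl, by simp⟩
  · rintro S T hST ⟨M, hM, h⟩
    exact ⟨M, hM, fun k hk => h k (hST hk)⟩
  · rintro S T ⟨M, hM, h⟩ ⟨M', -, h'⟩
    refine ⟨max M M', hM.trans (le_max_left _ _), ?_⟩
    rintro k (hk | hk) γ hγ
    · exact h k hk γ (Gamma_anti (le_max_left _ _) hγ)
    · exact h' k hk γ (Gamma_anti (le_max_right _ _) hγ)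
  · intro k _
    obtain ⟨M, hM, h⟩ := exists_level_local x hx hf k a
    refine ⟨k • (Gamma F M : Set PGL(2, F)), mem_nhdsWithin_of_mem_nhds ?_, M, hM, ?_⟩
    · refine ((isOpen_Gamma M).smul k).mem_nhds ⟨1, one_mem _, mul_one k⟩
    · rintro _ ⟨γ', hγ', rfl⟩ γ hγ
      change f (k * γ' * γ * tor a) = tildeChar x γ * f (k * γ' * tor a)
      rw [mul_assoc k, h _ (mul_mem hγ' hγ), h _ hγ', tildeChar_mul_of_mem x hx
        (Gamma_anti hM hγ') (Gamma_anti hM hγ)]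
      ring

variable (F) in
/-- The image in `PGL(2, F)` of `diag(ϖ ^ n, 1)`. -/
def torPow (n : ℤ) : PGL(2, F) := tor (Units.mk0 (unif F) (unif_ne_zero F) ^ n)

theorem valuation_unif_zpow (n : ℤ) :
    valuation F ((Units.mk0 (unif F) (unif_ne_zero F) ^ n : Fˣ) : F) = pv F ^ n := by
  rw [Units.val_zpow_eq_zpow_val, map_zpow₀]
  rfl

/-- Left translation by `torPow F n` rescales slopes by `ϖ ^ n`, so level `M` turns into level `M +
n`; the bound `hM` makes `toNat` harmless. With the next lemma, the translate of `f_(M+n)` is `x̃`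
on `Γ_M ϖ^n U` and zero elsewhere. -/
theorem fAux_torPow (hx : 0 < depth x) {M : ℕ} {n : ℤ} (hM : (depth x : ℤ) ≤ M + n)
    {γ : PGL(2, F)} (hγ : γ ∈ Gamma F M) (hM0 : 0 < M) (b : F) :
    fAux x (M + n).toNat ((torPow F n)⁻¹ * (γ * torPow F n * unip b)) = tildeChar x γ := by
  obtain ⟨h1, h2⟩ := ratio_slope_of_mem_Gamma hM0 hγ
  rw [fAux, torPow, slope_tor_inv_mul, ratio_tor_inv_mul, slope_mul_unip, ratio_mul_unip,
    slope_mul_tor, ratio_mul_tor, inv_mul_cancel_left₀ (Units.ne_zero _), if_pos, tildeChar]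
  rw [map_mul, valuation_unif_zpow, ← zpow_natCast (pv F) (M + n).toNat,
    Int.toNat_of_nonneg (by omega), zpow_add₀ (pv_ne_zero F), mul_comm, zpow_natCast]
  exact mul_le_mul_left h2 _

theorem eq_and_mem_of_fAux_torPow_ne_zero (hx : 0 < depth x) {M : ℕ} {n n₀ : ℤ}
    (hM : (depth x : ℤ) ≤ M + n) {k : PGL(2, F)} (hk : k ∈ Gamma F 0) (hM0 : 0 < M) (b : F)
    (h : fAux x (M + n).toNat ((torPow F n)⁻¹ * (k * torPow F n₀ * unip b)) ≠ 0) :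
    n = n₀ ∧ k ∈ Gamma F M := by
  obtain ⟨h1, h2⟩ := (fAux_ne_zero_iff x _ _).1 h
  rw [torPow, slope_tor_inv_mul, slope_mul_unip, torPow, slope_mul_tor, map_mul,
    valuation_unif_zpow, ← zpow_natCast (pv F) (M + n).toNat, Int.toNat_of_nonneg (by omega),
    zpow_add₀ (pv_ne_zero F), mul_comm, mul_le_mul_iff_left₀ (zpow_pos (pv_pos F) n),
    zpow_natCast] at h1
  rw [torPow, ratio_tor_inv_mul, ratio_mul_unip, torPow, ratio_mul_tor, map_mul, map_mul,
    map_inv₀, valuation_unif_zpow, valuation_unif_zpow] at h2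
  have hr : ratio k ≠ 0 := by
    intro h0
    simp [h0] at h2
  have hkM := mem_Gamma_of_ratio_slope hk hr h1
  refine ⟨?_, hkM⟩
  rw [(ratio_slope_of_mem_Gamma hM0 hkM).1, mul_one] at h2
  have h3 : pv F ^ n = pv F ^ n₀ := by
    rw [inv_mul_eq_one₀ (zpow_ne_zero _ (pv_ne_zero F))] at h2
    exact h2
  exact zpow_right_injective₀ (pv_pos F) pv_lt_one.ne h3

/-- Finitely many of the open sets `K ϖ^n U` cover a compact set carrying the support modulo `U`.
Choosing the decomposition together with its exponent avoids proving that the exponent is unique. -/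
theorem exists_iwasawa_finset {f : PGL(2, F) → ℂ} (hf : f ∈ (V x).toSubmodule) :
    ∃ N : Finset ℤ, ∀ g, ∃ k ∈ Gamma F 0, ∃ (n : ℤ) (b : F),
      g = k * torPow F n * unip b ∧ (f g ≠ 0 → n ∈ N) := by
  obtain ⟨-, ⟨C, hC, hs⟩, -⟩ := hf
  obtain ⟨N, hN⟩ := hC.elim_finite_subcover
    (fun n : ℤ => (Gamma F 0 : Set PGL(2, F)) * ({torPow F n} * (U F : Set PGL(2, F))))
    (fun n => (isOpen_Gamma 0).mul_right) (by
      intro g _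
      obtain ⟨k, hk, n, b, rfl⟩ := exists_iwasawa g
      rw [mul_assoc]
      exact Set.mem_iUnion.2 ⟨n, Set.mul_mem_mul hk (Set.mul_mem_mul rfl ⟨b, rfl⟩)⟩)
  refine ⟨N, fun g => ?_⟩
  by_cases hg : f g = 0
  · obtain ⟨k, hk, n, b, h⟩ := exists_iwasawa g
    exact ⟨k, hk, n, b, h, fun h => absurd hg h⟩
  · obtain ⟨c, hc, _, ⟨b', rfl⟩, rfl⟩ := hs hg
    obtain ⟨n, hn, k, hk, _, ⟨_, rfl, _, ⟨b, rfl⟩, rfl⟩, rfl⟩ := Set.mem_iUnion₂.1 (hN hc)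
    refine ⟨k, hk, n, b + b', ?_, fun _ => hn⟩
    simp only [unip_add, mul_assoc]

theorem V_le_translateSpan (hx : 0 < depth x) :
    (V x).toSubmodule ≤ translateSpan (f0 x) := by
  intro f hf
  obtain ⟨N, hN⟩ := exists_iwasawa_finset x hf
  choose L hL hL' using fun n : ℤ => exists_level x hx hf
    (Units.mk0 (unif F) (unif_ne_zero F) ^ n)
  -- One level `M` serves all exponents in `N`: it exceeds every `L n`, and the summand `n.natAbs`
  -- keeps `M + n ≥ d` for negative `n`, so that `f_(M+n)` is in the span of translates of `f0`.
  obtain ⟨M, hMx, hM⟩ : ∃ M, depth x ≤ M ∧ ∀ n ∈ N, L n ≤ M ∧ (depth x : ℤ) ≤ M + n := by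
    refine ⟨N.sup (fun n => L n + n.natAbs) + depth x, Nat.le_add_left _ _, fun n hn => ?_⟩
    have := Finset.le_sup (f := fun n => L n + n.natAbs) hn
    have := hL n
    omega
  have hM0 : 0 < M := hx.trans_le hMx
  have hfin := finite_image_mk_of_isCompact (isOpen_Gamma (F := F) M)
    (isCompact_Gamma_zero (F := F))
  have key : f = ∑ p ∈ N ×ˢ hfin.toFinset, f (p.2.out * torPow F p.1) •
      leftShift PGL(2, F) (p.2.out * torPow F p.1) (fAux x (M + p.1).toNat) := by
    funext g
    obtain ⟨k, hk, n₀, b, rfl, hn₀⟩ := hN g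
    have hout : ∀ c ∈ hfin.toFinset, c.out ∈ Gamma F 0 := by
      intro c hc
      obtain ⟨k', hk', rfl⟩ := hfin.mem_toFinset.1 hc
      have : (k' : PGL(2, F) ⧸ Gamma F M).out⁻¹ * k' ∈ Gamma F M := by
        rw [← QuotientGroup.eq, QuotientGroup.out_eq']
      have h2 := mul_mem hk' (inv_mem (Gamma_anti (Nat.zero_le M) this))
      simpa using h2
    have hshift : ∀ (n : ℤ) (c : PGL(2, F) ⧸ Gamma F M), (c.out * torPow F n)⁻¹ *
        (k * torPow F n₀ * unip b) =
          (torPow F n)⁻¹ * (c.out⁻¹ * k * torPow F n₀ * unip b) := by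
      intro n c
      simp only [_root_.mul_inv_rev, mul_assoc]
    rw [Finset.sum_apply]
    have hz : ∀ p ∈ N ×ˢ hfin.toFinset, p ≠ (n₀, (k : PGL(2, F) ⧸ Gamma F M)) →
        (f (p.2.out * torPow F p.1) •
          leftShift PGL(2, F) (p.2.out * torPow F p.1) (fAux x (M + p.1).toNat))
            (k * torPow F n₀ * unip b) = 0 := by
      rintro ⟨n, c⟩ hp hne
      rw [Finset.mem_product] at hp
      rw [Pi.smul_apply, leftShift_apply, hshift]
      by_contra h
      obtain ⟨rfl, h2⟩ := eq_and_mem_of_fAux_torPow_ne_zero x hx (hM n hp.1).2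
        (mul_mem (inv_mem (hout c hp.2)) hk) hM0 b (right_ne_zero_of_smul h)
      rw [← QuotientGroup.eq, QuotientGroup.out_eq'] at h2
      exact hne (Prod.ext rfl h2)
    by_cases hn : n₀ ∈ N
    · have hkT : (k : PGL(2, F) ⧸ Gamma F M) ∈ hfin.toFinset :=
        hfin.mem_toFinset.2 ⟨k, hk, rfl⟩
      rw [Finset.sum_eq_single_of_mem (n₀, (k : PGL(2, F) ⧸ Gamma F M))
        (Finset.mem_product.2 ⟨hn, hkT⟩) hz]
      have hγ : (k : PGL(2, F) ⧸ Gamma F M).out⁻¹ * k ∈ Gamma F M := by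
        rw [← QuotientGroup.eq, QuotientGroup.out_eq']
      rw [Pi.smul_apply, leftShift_apply, hshift, fAux_torPow x hx (hM n₀ hn).2 hγ hM0,
        smul_eq_mul, mul_comm, torPow, ← hL' n₀ _ (hout _ hkT) _ (Gamma_anti (hM n₀ hn).1 hγ),
        mul_inv_cancel_left]
      have := hf.2.2 (k * torPow F n₀) 1 (unip b) ⟨b, rfl⟩
      rw [map_one, tor_one, mul_one, map_one, Units.val_one, one_mul] at this
      exact this
    · have : f (k * torPow F n₀ * unip b) = 0 := by
        by_contra h
        exact hn (hn₀ h)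
      rw [this, Finset.sum_eq_zero]
      intro p hp
      refine hz p hp ?_
      rintro rfl
      exact hn (Finset.mem_product.1 hp).1
  rw [key]
  refine Submodule.sum_mem _ fun p hp => Submodule.smul_mem _ _ ?_
  refine translateSpan_le (fAux_mem_translateSpan x hx ?_) (leftShift_mem_translateSpan _ _)
  have := (hM p.1 (Finset.mem_product.1 hp).1).2
  omega

end Generation

/-! ### The operator `A` and the identity `A(f₀) = φ₀` -/

section Convolution

variable {F : Type*} [Field F] [ValuativeRel F] [TopologicalSpace F]
  [IsNonarchimedeanLocalField F]

theorem measurableSet_Gamma (d : ℕ) : MeasurableSet (Gamma F d : Set PGL(2, F)) :=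
  (isOpen_Gamma d).measurableSet

theorem haar_Gamma_ne_zero (d : ℕ) :
    (Measure.haar : Measure PGL(2, F)) (Gamma F d : Set PGL(2, F)) ≠ 0 :=
  ((isOpen_Gamma d).measure_pos _ ⟨1, one_mem _⟩).ne'

theorem haar_Gamma_ne_top (d : ℕ) :
    (Measure.haar : Measure PGL(2, F)) (Gamma F d : Set PGL(2, F)) ≠ ⊤ :=
  (isCompact_Gamma d).measure_lt_top.ne

instance isProbabilityMeasure_ch (d : ℕ) : IsProbabilityMeasure (ch (Gamma F d)) := by
  constructor
  rw [ch, Measure.smul_apply, Measure.restrict_apply_univ, smul_eq_mul]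
  exact ENNReal.inv_mul_cancel (haar_Gamma_ne_zero d) (haar_Gamma_ne_top d)

theorem ae_mem_Gamma (d : ℕ) : ∀ᵐ h ∂ch (Gamma F d), h ∈ Gamma F d :=
  Measure.ae_smul_measure (ae_restrict_mem (measurableSet_Gamma d)) _

/-- The normalized Haar measure of the compact group `Γ_d` is right invariant. -/
theorem map_mul_right_ch (d : ℕ) {γ : PGL(2, F)} (hγ : γ ∈ Gamma F d) :
    Measure.map (· * γ) (ch (Gamma F d)) = ch (Gamma F d) := by
  set Γ : Set PGL(2, F) := (Gamma F d : Set PGL(2, F)) with hΓ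
  let μ : Measure PGL(2, F) := Measure.haar
  have hm : Measurable (· * γ : PGL(2, F) → PGL(2, F)) := (continuous_mul_const γ).measurable
  have hpre : (· * γ) ⁻¹' Γ = Γ := by
    ext h
    exact Subgroup.mul_mem_cancel_right _ hγ
  -- A right translate of Haar measure is again left invariant, hence proportional to it on subsets
  -- of the compact `Γ_d`; evaluation on `Γ_d` itself gives the factor `1`, without unimodularity of
  -- `G`.
  have hscal : ∀ s ⊆ Γ, Measure.map (· * γ) μ s =
      Measure.haarScalarFactor (Measure.map (· * γ) μ) μ • μ s := fun s hs =>
    Measure.measure_isMulInvariant_eq_smul_of_isCompact_closure _ _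
      ((isCompact_Gamma d).of_isClosed_subset isClosed_closure
        (closure_minimal hs (isClosed_Gamma d)))
  have hone : (Measure.haarScalarFactor (Measure.map (· * γ) μ) μ : ENNReal) = 1 := by
    have h := hscal Γ subset_rfl
    rw [Measure.map_apply hm (measurableSet_Gamma d), hpre, ENNReal.smul_def, smul_eq_mul] at h
    have h' := (ENNReal.mul_left_inj (haar_Gamma_ne_zero d) (haar_Gamma_ne_top d)).1
      ((one_mul _).trans h)
    exact h'.symm
  have hres : (Measure.map (· * γ) μ).restrict Γ = μ.restrict Γ := by
    ext s hs
    rw [Measure.restrict_apply hs, Measure.restrict_apply hs, hscal _ Set.inter_subset_right,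
      ENNReal.smul_def, hone, one_smul]
  rw [ch, Measure.map_smul, ← hΓ]
  congr 1
  have h := Measure.restrict_map (μ := μ) hm (measurableSet_Gamma (F := F) d)
  rw [hpre, hres] at h
  exact h.symm

theorem integral_mul_right_ch (d : ℕ) {γ : PGL(2, F)} (hγ : γ ∈ Gamma F d) (f : PGL(2, F) → ℂ) :
    ∫ h, f (h * γ) ∂ch (Gamma F d) = ∫ h, f h ∂ch (Gamma F d) := by
  have hemb : MeasurableEmbedding (· * γ : PGL(2, F) → PGL(2, F)) :=
    (Homeomorph.mulRight γ).measurableEmbedding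
  rw [← hemb.integral_map, map_mul_right_ch d hγ]

variable (x : 𝒪[F]ˣ →ₜ* ℂˣ)

theorem integrable_opA (hx : 0 < depth x) {f : PGL(2, F) → ℂ} (hf : f ∈ (V x).toSubmodule)
    (g : PGL(2, F)) :
    Integrable (fun h => f (g * h⁻¹) * phi0 x h) (ch (Gamma F (depth x))) := by
  obtain ⟨h1, h2, -⟩ := phi0_mem x hx
  have hc : Continuous fun h => f (g * h⁻¹) :=
    hf.1.continuous.comp (continuous_inv.const_mul g)
  exact (hc.mul h1.continuous).integrable_of_hasCompactSupport h2.mul_left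

theorem opA_leftShift (f : PGL(2, F) → ℂ) (g : PGL(2, F)) :
    opA x (leftShift PGL(2, F) g f) = leftShift PGL(2, F) g (opA x f) := by
  funext h
  simp only [opA, conv, leftShift_apply, mul_assoc]

theorem opA_add (hx : 0 < depth x) {f f' : PGL(2, F) → ℂ} (hf : f ∈ (V x).toSubmodule)
    (hf' : f' ∈ (V x).toSubmodule) : opA x (f + f') = opA x f + opA x f' := by
  funext g
  simp only [opA, conv, Pi.add_apply, add_mul]
  exact integral_add (integrable_opA x hx hf g) (integrable_opA x hx hf' g)

theorem opA_smul (c : ℂ) (f : PGL(2, F) → ℂ) : opA x (c • f) = c • opA x f := by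
  funext g
  simp only [opA, conv, Pi.smul_apply, smul_eq_mul, mul_assoc]
  exact integral_const_mul _ _

theorem opA_mul_right (hx : 0 < depth x) (f : PGL(2, F) → ℂ) {γ : PGL(2, F)}
    (hγ : γ ∈ Gamma F (depth x)) (g : PGL(2, F)) :
    opA x f (g * γ) = tildeChar x γ * opA x f g := by
  rw [opA, conv, conv, ← integral_mul_right_ch _ hγ, ← integral_const_mul]
  congr 1
  funext h
  rw [phi0_mul_right x hx hγ, _root_.mul_inv_rev, mul_assoc g, mul_inv_cancel_left]
  ring

theorem opA_f0_mul_left (hx : 0 < depth x) {γ : PGL(2, F)}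
    (hγ : γ ∈ Gamma F (depth x)) (g : PGL(2, F)) :
    opA x (f0 x) (γ * g) = tildeChar x γ * opA x (f0 x) g := by
  rw [opA, conv, conv, ← integral_const_mul]
  congr 1
  funext h
  rw [mul_assoc γ, f0_mul_left x hx hγ, mul_assoc]

theorem opA_f0_one (hx : 0 < depth x) : opA x (f0 x) 1 = 1 := by
  have : ∀ᵐ h ∂ch (Gamma F (depth x)), f0 x (1 * h⁻¹) * phi0 x h = 1 := by
    filter_upwards [ae_mem_Gamma (depth x)] with h hh
    have h1 := f0_mul x (inv_mem hh) (one_mem (U F))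
    rw [mul_one] at h1
    rw [one_mul, h1, phi0_of_mem x hh, tildeChar_inv x hx hh,
      inv_mul_cancel₀ (tildeChar_ne_zero x hx hh)]
  rw [opA, conv, integral_congr_ae this]
  simp

/-- The elements `γ₁, γ₂ ∈ Γ_d` below satisfy `γ₁ u = u γ₂` with `u = unip b`, and `x̃` takes the
values `x(1 + c)⁻¹` and `x(1 + c)` on them. These differ as `x((1 + c) ^ 2) ≠ 1`, so two-sided
equivariance forces the value at `u` to vanish. -/
theorem opA_f0_unip (hx : 0 < depth x) {b : F} (hb : 1 < valuation F b) :
    opA x (f0 x) (unip b) = 0 := by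
  obtain ⟨c, hc1, hc2, hc3⟩ := exists_extChar_sq_ne_one x hx
  have hb0 : b ≠ 0 := by
    rintro rfl
    simp at hb
  have hc0 : 1 + c ≠ 0 := (valuation F).ne_zero_iff.1 (by rw [hc2]; exact one_ne_zero)
  -- Here `c` supplies `d - 1` powers of the uniformizer and `b⁻¹` the missing one.
  have hr : valuation F (-c / b) ≤ pv F ^ depth x := by
    have h1 : valuation F b⁻¹ ≤ pv F := by
      rw [le_pv_iff_lt_one, map_inv₀]
      exact inv_lt_one_of_one_lt₀ hb
    rw [div_eq_mul_inv, map_mul, Valuation.map_neg, ← Nat.sub_add_cancel hx, pow_succ]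
    exact mul_le_mul' hc1 h1
  let γ₁ : GL (Fin 2) F := GeneralLinearGroup.mkOfDetNeZero !![1, 0; -c / b, 1 + c]
    (by simpa using hc0)
  let γ₂ : GL (Fin 2) F := GeneralLinearGroup.mkOfDetNeZero !![1 + c, 0; -c / b, 1]
    (by simpa using hc0)
  have hγ₁ : ProjGenLinGroup.mk γ₁ ∈ Gamma F (depth x) := by
    refine mk_mem_Gamma _ (fun i j => ?_) ?_ hr
    · fin_cases i <;> fin_cases j
      · exact (map_one _).le
      · exact (map_zero _).trans_le zero_le
      · exact hr.trans (pv_pow_le_one _)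
      · exact hc2.le
    · simpa [γ₁, GeneralLinearGroup.mkOfDetNeZero] using hc2
  have hγ₂ : ProjGenLinGroup.mk γ₂ ∈ Gamma F (depth x) := by
    refine mk_mem_Gamma _ (fun i j => ?_) ?_ hr
    · fin_cases i <;> fin_cases j
      · exact hc2.le
      · exact (map_zero _).trans_le zero_le
      · exact hr.trans (pv_pow_le_one _)
      · exact (map_one _).le
    · simpa [γ₂, GeneralLinearGroup.mkOfDetNeZero] using hc2
  have hcomm : ProjGenLinGroup.mk γ₁ * unip b = unip b * ProjGenLinGroup.mk γ₂ := by
    rw [unip, ← map_mul, ← map_mul]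
    congr 1
    ext i j
    fin_cases i <;> fin_cases j <;>
      simp [γ₁, γ₂, GeneralLinearGroup.upperRightHom, GeneralLinearGroup.mkOfDetNeZero] <;>
      field_simp <;> ring
  have h1 : tildeChar x (ProjGenLinGroup.mk γ₁) = extChar x (1 + c)⁻¹ := by
    rw [tildeChar, ratio_mk']
    simp [γ₁, GeneralLinearGroup.mkOfDetNeZero]
  have h2 : tildeChar x (ProjGenLinGroup.mk γ₂) = extChar x (1 + c) := by
    rw [tildeChar, ratio_mk']
    simp [γ₂, GeneralLinearGroup.mkOfDetNeZero]
    congr 1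
    field_simp
  have key := opA_f0_mul_left x hx hγ₁ (unip b)
  rw [hcomm, opA_mul_right x hx _ hγ₂, h1, h2] at key
  by_contra hne
  have h3 := mul_right_cancel₀ hne key
  apply hc3
  rw [sq, extChar_mul x hc2]
  nth_rewrite 2 [h3]
  rw [← extChar_mul x hc2, mul_inv_cancel₀ hc0, extChar_one]

theorem opA_f0 (hx : 0 < depth x) : opA x (f0 x) = phi0 x := by
  have hΓ : ∀ γ ∈ Gamma F (depth x), opA x (f0 x) γ = phi0 x γ := by
    intro γ hγ
    have := opA_f0_mul_left x hx hγ 1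
    rwa [mul_one, opA_f0_one x hx, mul_one, ← phi0_of_mem x hγ] at this
  funext g
  by_cases hg : g ∈ Gamma F (depth x)
  · exact hΓ g hg
  rw [phi0_of_notMem x hg]
  by_cases hg' : ∃ γ ∈ Gamma F (depth x), ∃ b, ∃ γ' ∈ Gamma F (depth x), g = γ * unip b * γ'
  · obtain ⟨γ, hγ, b, γ', hγ', rfl⟩ := hg'
    rw [opA_mul_right x hx _ hγ', opA_f0_mul_left x hx hγ, opA_f0_unip x hx, mul_zero, mul_zero]
    by_contra hb
    exact hg (mul_mem (mul_mem hγ (unip_mem_Gamma (not_lt.1 hb))) hγ')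
  -- Outside `Γ_d U Γ_d` the integrand is identically zero.
  · rw [opA, conv]
    apply integral_eq_zero_of_ae
    refine Filter.Eventually.of_forall fun h => ?_
    by_cases hh : h ∈ Gamma F (depth x)
    · have : f0 x (g * h⁻¹) = 0 := by
        refine Set.indicator_of_notMem ?_ _
        rintro ⟨γ, hγ, _, ⟨b, rfl⟩, e⟩
        exact hg' ⟨γ, hγ, b, h, hh, by rw [eq_comm, ← eq_mul_inv_iff_mul_eq]; exact e⟩
      simp [this]
    · simp [phi0_of_notMem x hh]

end Convolution

/-! ### The operator `B` and the identity `B(φ₀) = f₀` -/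

section Averaging

variable {F : Type*} [Field F] [ValuativeRel F] [TopologicalSpace F]
  [IsNonarchimedeanLocalField F]

variable (F) in
/-- The Haar measure on `F` giving volume one to `𝒪`. -/
def unitHaar : @Measure F (borel F) :=
  letI : MeasurableSpace F := borel F
  haveI : BorelSpace F := ⟨rfl⟩
  (Measure.addHaar (𝒪[F] : Set F))⁻¹ • (Measure.addHaar : Measure F)

theorem opB_apply (φ : PGL(2, F) → ℂ) (g : PGL(2, F)) :
    opB φ g = @integral F ℂ _ _ (borel F) (unitHaar F) fun b => φ (g * unip b) := rfl

variable (x : 𝒪[F]ˣ →ₜ* ℂˣ)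

theorem phi0_mul_unip {γ : PGL(2, F)} (hx : 0 < depth x) (hγ : γ ∈ Gamma F (depth x)) (b : F) :
    phi0 x (γ * unip b) = Set.indicator (𝒪[F] : Set F) (fun _ => tildeChar x γ) b := by
  by_cases hb : b ∈ (𝒪[F] : Set F)
  · have hub : unip b ∈ Gamma F (depth x) := unip_mem_Gamma hb
    rw [Set.indicator_of_mem hb, phi0_mul_left x hx hγ, phi0_of_mem x hub, tildeChar,
      tildeChar, ← one_mul (unip b), ratio_mul_unip, ratio_one, extChar_one, mul_one]
  · rw [Set.indicator_of_notMem hb, phi0_of_notMem]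
    rw [Subgroup.mul_mem_cancel_left _ hγ]
    exact fun h => hb (valuation_le_one_of_unip_mem h)

/-- Along a coset `γ U` with `γ ∈ Γ_d`, `phi0` is `x̃(γ)` times the indicator of a translate of `𝒪`,
which has volume one; off `Γ_d U` it vanishes on the whole coset. Integrability is recorded because
the additivity of `B` needs it. -/
theorem integrable_and_opB_phi0 (hx : 0 < depth x) (g : PGL(2, F)) :
    (letI : MeasurableSpace F := borel F;
      Integrable (fun b => phi0 x (g * unip b)) (unitHaar F)) ∧
      opB (phi0 x) g = f0 x g := by
  let : MeasurableSpace F := borel F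
  have : BorelSpace F := ⟨rfl⟩
  rw [opB_apply]
  have hO : IsOpen (𝒪[F] : Set F) := isOpen_valuation_le one_ne_zero
  have hOc : IsCompact (𝒪[F] : Set F) := IsNonarchimedeanLocalField.isCompact_closedBall F 1
  have h0 : (Measure.addHaar : Measure F) (𝒪[F] : Set F) ≠ 0 :=
    (hO.measure_pos _ ⟨0, zero_mem _⟩).ne'
  have ht : (Measure.addHaar : Measure F) (𝒪[F] : Set F) ≠ ⊤ := hOc.measure_lt_top.ne
  have h1 : unitHaar F (𝒪[F] : Set F) = 1 := by
    rw [unitHaar, Measure.smul_apply, smul_eq_mul]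
    exact ENNReal.inv_mul_cancel h0 ht
  have hinv : (unitHaar F).IsAddRightInvariant := by
    have : (unitHaar F).IsAddLeftInvariant := by
      rw [unitHaar]
      infer_instance
    infer_instance
  by_cases hg : g ∈ (Gamma F (depth x) : Set PGL(2, F)) * (U F : Set PGL(2, F))
  · obtain ⟨γ, hγ, _, ⟨b₀, rfl⟩, rfl⟩ := hg
    have e : (fun b => phi0 x (γ * unip b₀ * unip b)) = fun b =>
        Set.indicator (𝒪[F] : Set F) (fun _ => tildeChar x γ) (b + b₀) := by
      funext b
      rw [mul_assoc, ← unip_add, add_comm, phi0_mul_unip x hx hγ]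
    have hint : Integrable (Set.indicator (𝒪[F] : Set F) (fun _ => tildeChar x γ))
        (unitHaar F) := by
      refine (integrable_indicator_iff hO.measurableSet).2 (integrableOn_const ?_)
      rw [h1]
      exact ENNReal.one_ne_top
    change Integrable (fun b => phi0 x (γ * unip b₀ * unip b)) _ ∧
      ∫ b, phi0 x (γ * unip b₀ * unip b) ∂_ = f0 x (γ * unip b₀)
    rw [e]
    refine ⟨hint.comp_add_right b₀, ?_⟩
    rw [integral_add_right_eq_self (Set.indicator (𝒪[F] : Set F) fun _ => tildeChar x γ),
      integral_indicator_const _ hO.measurableSet, f0_mul x hγ ⟨b₀, rfl⟩, Measure.real, h1]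
    simp
  · have e : (fun b => phi0 x (g * unip b)) = fun _ => 0 := by
      funext b
      refine phi0_of_notMem x fun h => hg ⟨_, h, unip (-b), ⟨_, rfl⟩, ?_⟩
      simp only [unip_neg, mul_inv_cancel_right]
    rw [e, f0, Set.indicator_of_notMem hg]
    exact ⟨integrable_zero _ _ _, integral_zero _ _⟩

theorem opB_leftShift (φ : PGL(2, F) → ℂ) (g : PGL(2, F)) :
    opB (leftShift PGL(2, F) g φ) = leftShift PGL(2, F) g (opB φ) := by
  funext h
  simp only [opB, leftShift_apply, mul_assoc]

theorem opB_smul (c : ℂ) (φ : PGL(2, F) → ℂ) : opB (c • φ) = c • opB φ := by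
  funext g
  simp only [opB, Pi.smul_apply, smul_eq_mul]
  exact integral_const_mul _ _

theorem integrable_opB (hx : 0 < depth x) {φ : PGL(2, F) → ℂ} (hφ : φ ∈ (W x).toSubmodule)
    (g : PGL(2, F)) :
    letI : MeasurableSpace F := borel F
    Integrable (fun b => φ (g * unip b)) (unitHaar F) := by
  let : MeasurableSpace F := borel F
  have hspan : φ ∈ Submodule.span ℂ (Set.range fun g => leftShift PGL(2, F) g (phi0 x)) :=
    W_le_translateSpan x hφ
  suffices h : ∀ g, Integrable (fun b => φ (g * unip b)) (unitHaar F) from h g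
  clear hφ g
  induction hspan using Submodule.span_induction with
  | mem φ h =>
    obtain ⟨g', rfl⟩ := h
    intro g
    simpa only [leftShift_apply, mul_assoc] using (integrable_and_opB_phi0 x hx (g'⁻¹ * g)).1
  | zero => exact fun g => integrable_zero _ _ _
  | add φ φ' _ _ h h' => exact fun g => (h g).add (h' g)
  | smul c φ _ h => exact fun g => (h g).const_mul c

theorem opB_add (hx : 0 < depth x) {φ φ' : PGL(2, F) → ℂ} (hφ : φ ∈ (W x).toSubmodule)
    (hφ' : φ' ∈ (W x).toSubmodule) : opB (φ + φ') = opB φ + opB φ' := by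
  funext g
  exact integral_add (integrable_opB x hx hφ g) (integrable_opB x hx hφ' g)

theorem opB_phi0 (hx : 0 < depth x) : opB (phi0 x) = f0 x :=
  funext fun g => (integrable_and_opB_phi0 x hx g).2

end Averaging

/-! ### `A` and `B` are mutually inverse -/

section Inverse

variable {F : Type*} [Field F] [ValuativeRel F] [TopologicalSpace F]
  [IsNonarchimedeanLocalField F] (x : 𝒪[F]ˣ →ₜ* ℂˣ)

/-- Checked on translates of `f0` and extended by linearity. The memberships are carried through the
induction because `opA_add` and `opB_add` rely on them for integrability. -/
theorem opA_mem_and_opB_opA (hx : 0 < depth x) {f : PGL(2, F) → ℂ}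
    (hf : f ∈ (V x).toSubmodule) : opA x f ∈ (W x).toSubmodule ∧ opB (opA x f) = f := by
  have := Submodule.span_induction (p := fun f _ => f ∈ (V x).toSubmodule ∧
    opA x f ∈ (W x).toSubmodule ∧ opB (opA x f) = f) ?_ ?_ ?_ ?_ (V_le_translateSpan x hx hf)
  · exact this.2
  · rintro _ ⟨g, rfl⟩
    rw [opA_leftShift, opA_f0 x hx, opB_leftShift, opB_phi0 x hx]
    exact ⟨(V x).apply_mem_toSubmodule g (f0_mem x hx),
      (W x).apply_mem_toSubmodule g (phi0_mem x hx), rfl⟩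
  · have hA := opA_smul x (0 : ℂ) 0
    have hB := opB_smul (F := F) (0 : ℂ) 0
    rw [zero_smul, zero_smul] at hA hB
    rw [hA, hB]
    exact ⟨zero_mem _, zero_mem _, rfl⟩
  · rintro f f' - - ⟨h1, h2, h3⟩ ⟨h1', h2', h3'⟩
    rw [opA_add x hx h1 h1', opB_add x hx h2 h2', h3, h3']
    exact ⟨add_mem h1 h1', add_mem h2 h2', rfl⟩
  · rintro c f - ⟨h1, h2, h3⟩
    rw [opA_smul, opB_smul, h3]
    exact ⟨Submodule.smul_mem _ _ h1, Submodule.smul_mem _ _ h2, rfl⟩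

theorem opB_mem_and_opA_opB (hx : 0 < depth x) {φ : PGL(2, F) → ℂ}
    (hφ : φ ∈ (W x).toSubmodule) : opB φ ∈ (V x).toSubmodule ∧ opA x (opB φ) = φ := by
  have := Submodule.span_induction (p := fun φ _ => φ ∈ (W x).toSubmodule ∧
    opB φ ∈ (V x).toSubmodule ∧ opA x (opB φ) = φ) ?_ ?_ ?_ ?_ (W_le_translateSpan x hφ)
  · exact this.2
  · rintro _ ⟨g, rfl⟩
    rw [opB_leftShift, opB_phi0 x hx, opA_leftShift, opA_f0 x hx]
    exact ⟨(W x).apply_mem_toSubmodule g (phi0_mem x hx),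
      (V x).apply_mem_toSubmodule g (f0_mem x hx), rfl⟩
  · have hA := opA_smul x (0 : ℂ) 0
    have hB := opB_smul (F := F) (0 : ℂ) 0
    rw [zero_smul, zero_smul] at hA hB
    rw [hB, hA]
    exact ⟨zero_mem _, zero_mem _, rfl⟩
  · rintro φ φ' - - ⟨h1, h2, h3⟩ ⟨h1', h2', h3'⟩
    rw [opB_add x hx h1 h1', opA_add x hx h2 h2', h3, h3']
    exact ⟨add_mem h1 h1', add_mem h2 h2', rfl⟩
  · rintro c φ - ⟨h1, h2, h3⟩
    rw [opB_smul, opA_smul, h3]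
    exact ⟨Submodule.smul_mem _ _ h1, Submodule.smul_mem _ _ h2, rfl⟩

/-- The operator `A` as an isomorphism of representations. -/
def equivA (hx : 0 < depth x) : (tau x).Equiv (rho x) :=
  Representation.Equiv.mk
    { toFun := fun f => ⟨opA x f, (opA_mem_and_opB_opA x hx f.2).1⟩
      map_add' := fun f f' => Subtype.ext (opA_add x hx f.2 f'.2)
      map_smul' := fun c f => Subtype.ext (opA_smul x c f)
      invFun := fun φ => ⟨opB φ, (opB_mem_and_opA_opB x hx φ.2).1⟩
      left_inv := fun f => Subtype.ext (opA_mem_and_opB_opA x hx f.2).2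
      right_inv := fun φ => Subtype.ext (opB_mem_and_opA_opB x hx φ.2).2 }
    fun g => LinearMap.ext fun f => Subtype.ext (opA_leftShift x f g)

theorem coe_equivA (hx : 0 < depth x) (f : (V x).toSubmodule) :
    (equivA x hx f : PGL(2, F) → ℂ) = opA x f := rfl

theorem coe_equivA_symm (hx : 0 < depth x) (φ : (W x).toSubmodule) :
    ((equivA x hx).symm φ : PGL(2, F) → ℂ) = opB φ := rfl

end Inverse

/-! ### Conjugation of endomorphism algebras -/

section Endomorphisms

variable {k G M N : Type*} [CommSemiring k] [Monoid G] [AddCommMonoid M] [AddCommMonoid N]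
  [Module k M] [Module k N] {ρ : Representation k G M} {σ : Representation k G N}

/-- Conjugation by an isomorphism of representations, as an isomorphism of endomorphism
algebras. -/
def endConj (A : ρ.Equiv σ) : ρ.IntertwiningMap ρ ≃ₐ[k] σ.IntertwiningMap σ :=
  AlgEquiv.ofLinearEquiv
    { toFun := fun S => (A.toIntertwiningMap.comp S).comp A.symm.toIntertwiningMap
      map_add' := fun S T => by ext; simp
      map_smul' := fun c S => by ext; simp
      invFun := fun S => (A.symm.toIntertwiningMap.comp S).comp A.toIntertwiningMap
      left_inv := fun S => by ext; simp
      right_inv := fun S => by ext; simp }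
    (by ext; simp) (fun S T => by ext; simp)

theorem endConj_apply (A : ρ.Equiv σ) (S : ρ.IntertwiningMap ρ) (m : M) :
    endConj A S (A m) = A (S m) := by
  change A (S (A.symm (A m))) = _
  rw [A.symm_apply_apply]

end Endomorphisms

end PGLTwo

end

open PGLTwo in
theorem lemma5p1 {F : Type*} [Field F] [ValuativeRel F] [TopologicalSpace F]
    [IsNonarchimedeanLocalField F] (x : 𝒪[F]ˣ →ₜ* ℂˣ) (hx : 0 < depth x) :
    ∃ (hf₀ : f0 x ∈ (V x).toSubmodule) (hφ₀ : phi0 x ∈ (W x).toSubmodule)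
      (A : (tau x).Equiv (rho x)) (B : (rho x).IntertwiningMap (tau x)),
      (∀ f : (V x).toSubmodule, (A f : PGL(2, F) → ℂ) = opA x f) ∧
      (∀ φ : (W x).toSubmodule, (B φ : PGL(2, F) → ℂ) = opB φ) ∧
      B ⟨phi0 x, hφ₀⟩ = ⟨f0 x, hf₀⟩ ∧
      A ⟨f0 x, hf₀⟩ = ⟨phi0 x, hφ₀⟩ ∧
      ∃ e : (tau x).IntertwiningMap (tau x) ≃ₐ[ℂ] (rho x).IntertwiningMap (rho x),
        ∀ S f, e S (A f) = A (S f) :=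
  ⟨f0_mem x hx, phi0_mem x hx, equivA x hx, (equivA x hx).symm.toIntertwiningMap,
    coe_equivA x hx, coe_equivA_symm x hx, Subtype.ext (opB_phi0 x hx),
    Subtype.ext (opA_f0 x hx), endConj (equivA x hx), endConj_apply (equivA x hx)⟩
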